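/- Let $n\ge 2$ be an integer, $0<\alpha\le 2$, $r>0$, and for $\rho>0$ put $\Omega_\rho=\{x\in\mathbb R^n: |x|>\rho\}$. For $x\ne y$ in $\Omega_r$ let $$G_\alpha(x,y)=\frac{C_{n,\alpha}}{|x-y|^{n-\alpha}}\int_0^{\frac{(|x|^2-r^2)(|y|^2-r^2)}{r^2|x-y|^2}}\frac{b^{\frac{\alpha}{2}-1}}{(1+b)^{\frac n2}}\,db,$$ and let $G_\alpha(x,y)=0$ if $x\notin\Omega_r$ or $y\notin\Omega_r$, where $C_{n,\alpha}>0$ is a constant; for the appropriate normalising constant this is the Dirichlet Green's function of $(-\Delta)^{\alpha/2}$ in $\Omega_r$, and the result holds for every $C_{n,\alpha}>0$. Let $f:\Omega_r\times[0,\infty)\to[0,\infty)$ satisfy the following conditions. (Subcritical growth) If $\alpha<n$, the map $\mu\mapsto \mu^{\frac{n+\alpha}{n-\alpha}} f\big(\mu^{\frac{2}{n-\alpha}}x,\mu^{-1}u\big)$ is strictly increasing on $\mu\ge1$ for all $(x,u)\in\Omega_r\times(0,\infty)$, or it is strictly increasing on $\{0<\mu\le 1:\ \mu^{\frac{2}{n-\alpha}}x\in\Omega_r\}$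 for all $(x,u)\in\Omega_r\times(0,\infty)$. If $\alpha=n$ (that is, $\alpha=n=2$), the same alternative holds for the map $\mu\mapsto\mu^n f(\mu x,u)$, with $\mu\ge 1$ or with $\{0<\mu\le1:\ \mu x\in\Omega_r\}$. ($\mathbf{f_1}$) For every $x\in\Omega_r$, $f(x,\cdot)$ is non-decreasing on $[0,\infty)$. ($\mathbf{f_2}$) There is a real number $\theta<\frac{\alpha}{n}$ such that $g(x,u)=(|x|-r)^\theta f(x,u)$ is locally Lipschitz on $u$: for every $u_0\ge0$ and every bounded $\omega\subseteq\Omega_r$ there are a relatively open neighbourhood $U\subseteq[0,\infty)$ of $u_0$ and a constant $L$ with $|g(x,u)-g(x,v)|\le L|u-v|$ for all $x\in\omega$ and $u,v\in U$. ($\mathbf{f_3}$) There are a cone $\mathcal C\subseteq\mathbb R^n$ with vertex at $0$ (a set with nonempty interior and with $t\,\mathcal C\subseteq\mathcal C$ for all $t>0$) and real constants $\overline C>0$, $\sigma>1$, $\tau$, $p>0$, with $\tau>-\alpha$ and $p<\frac{n+\alpha+2\tau}{n-\alpha}$ if $\alpha<n$, and with $\tau\ge-\alpha$ if $\alpha=n$,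 such that $f(x,u)\ge\overline C|x|^\tau u^p$ for all $x\in\mathcal C\cap\Omega_{2\sigma r}$ and $u\ge0$. Let $u\in C(\overline{\Omega_r})$ be nonnegative and satisfy $$u(x)=\int_{\Omega_r}G_\alpha(x,y)\,f(y,u(y))\,dy\qquad\text{for all }x\in\overline{\Omega_r},$$ the integral being convergent. Then $u\equiv0$ in $\overline{\Omega_r}$. -/

import Mathlib

open MeasureTheory Set

noncomputable section

namespace ExteriorLiouville

/-- The exterior domain `Ω_r = {x ∈ ℝⁿ : |x| > r}`. -/
def exteriorDomain (n : ℕ) (r : ℝ) : Set (EuclideanSpace ℝ (Fin n)) :=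
  {x | r < ‖x‖}

open Classical in
/-- The Dirichlet Green's function of `(-Δ)^{α/2}` in `Ω_r`, with normalisation constant `c`:
`c |x-y|^{α-n} ∫_0^{s(x,y)} b^{α/2-1} (1+b)^{-n/2} db` for `x, y ∈ Ω_r`, where
`s(x,y) = (|x|²-r²)(|y|²-r²) / (r²|x-y|²)`, and `0` if `x ∉ Ω_r` or `y ∉ Ω_r`.
(The value on the null set `x = y` is immaterial.) -/
def green (n : ℕ) (α r c : ℝ) (x y : EuclideanSpace ℝ (Fin n)) : ℝ :=
  if x ∈ exteriorDomain n r ∧ y ∈ exteriorDomain n r then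
    c / ‖x - y‖ ^ ((n : ℝ) - α) *
      ∫ b in (0 : ℝ)..((‖x‖ ^ 2 - r ^ 2) * (‖y‖ ^ 2 - r ^ 2) / (r ^ 2 * ‖x - y‖ ^ 2)),
        b ^ (α / 2 - 1) / (1 + b) ^ ((n : ℝ) / 2)
  else 0

/-- Subcritical growth. The nonlinearity is defined on `Ω_r × [0, ∞)` only, so for `μ ≤ 1` the
parameter runs over those `μ` for which the rescaled point still lies in `Ω_r`. -/
def Subcritical (n : ℕ) (α r : ℝ) (f : EuclideanSpace ℝ (Fin n) → ℝ → ℝ) : Prop :=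
  (α < n →
    (∀ x ∈ exteriorDomain n r, ∀ u : ℝ, 0 < u →
      StrictMonoOn (fun μ : ℝ => μ ^ (((n : ℝ) + α) / ((n : ℝ) - α)) *
        f (μ ^ (2 / ((n : ℝ) - α)) • x) (μ⁻¹ * u)) {μ | 1 ≤ μ}) ∨
    (∀ x ∈ exteriorDomain n r, ∀ u : ℝ, 0 < u →
      StrictMonoOn (fun μ : ℝ => μ ^ (((n : ℝ) + α) / ((n : ℝ) - α)) *
        f (μ ^ (2 / ((n : ℝ) - α)) • x) (μ⁻¹ * u))
        {μ | 0 < μ ∧ μ ≤ 1 ∧ μ ^ (2 / ((n : ℝ) - α)) • x ∈ exteriorDomain n r})) ∧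
  (α = n →
    (∀ x ∈ exteriorDomain n r, ∀ u : ℝ, 0 < u →
      StrictMonoOn (fun μ : ℝ => μ ^ n * f (μ • x) u) {μ | 1 ≤ μ}) ∨
    (∀ x ∈ exteriorDomain n r, ∀ u : ℝ, 0 < u →
      StrictMonoOn (fun μ : ℝ => μ ^ n * f (μ • x) u)
        {μ | 0 < μ ∧ μ ≤ 1 ∧ μ • x ∈ exteriorDomain n r}))

/-- `g(x,u)` is locally Lipschitz on `u` in `Ω_r × [0, ∞)`: for all `u₀ ≥ 0` and all bounded
`ω ⊆ Ω_r` there is a relatively open neighbourhood `V ∩ [0, ∞)` of `u₀` on which `g(x, ·)` is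
Lipschitz, uniformly in `x ∈ ω`. The set `ω` may touch the sphere `|x| = r`. -/
def LocallyLipschitzOnU (n : ℕ) (r : ℝ) (g : EuclideanSpace ℝ (Fin n) → ℝ → ℝ) : Prop :=
  ∀ u₀ : ℝ, 0 ≤ u₀ → ∀ ω ⊆ exteriorDomain n r, Bornology.IsBounded ω →
    ∃ V : Set ℝ, IsOpen V ∧ u₀ ∈ V ∧ ∃ L : ℝ, ∀ x ∈ ω, ∀ u ∈ V ∩ Ici 0, ∀ v ∈ V ∩ Ici 0,
      |g x u - g x v| ≤ L * |u - v|

/-- A (nondegenerate) cone with vertex at `0`: a set with nonempty interior that is invariant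
under multiplication by positive scalars. -/
def IsConeAtZero (n : ℕ) (K : Set (EuclideanSpace ℝ (Fin n))) : Prop :=
  (∀ x ∈ K, ∀ t : ℝ, 0 < t → t • x ∈ K) ∧ (interior K).Nonempty

/-- Assumption (f₁): `f(x, ·)` is non-decreasing on `[0, ∞)` for every `x ∈ Ω_r`. -/
def AssumptionF1 (n : ℕ) (r : ℝ) (f : EuclideanSpace ℝ (Fin n) → ℝ → ℝ) : Prop :=
  ∀ x ∈ exteriorDomain n r, ∀ u v : ℝ, 0 ≤ u → u ≤ v → f x u ≤ f x v

/-- Assumption (f₂): for some `θ < α/n`, `(|x|-r)^θ f(x,u)` is locally Lipschitz on `u`. -/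
def AssumptionF2 (n : ℕ) (α r : ℝ) (f : EuclideanSpace ℝ (Fin n) → ℝ → ℝ) : Prop :=
  ∃ θ : ℝ, θ < α / n ∧ LocallyLipschitzOnU n r (fun x u => (‖x‖ - r) ^ θ * f x u)

/-- Assumption (f₃): `f(x,u) ≥ C |x|^τ u^p` for `x` in the part of a cone outside the closed
ball of radius `2σr` and for all `u ≥ 0`. -/
def AssumptionF3 (n : ℕ) (α r : ℝ) (f : EuclideanSpace ℝ (Fin n) → ℝ → ℝ) : Prop :=
  ∃ (K : Set (EuclideanSpace ℝ (Fin n))) (C σ τ p : ℝ),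
    IsConeAtZero n K ∧ 0 < C ∧ 1 < σ ∧ 0 < p ∧
    ((α < n ∧ -α < τ ∧ p < ((n : ℝ) + α + 2 * τ) / ((n : ℝ) - α)) ∨ (α = n ∧ -α ≤ τ)) ∧
    ∀ x ∈ K ∩ exteriorDomain n (2 * σ * r), ∀ u : ℝ, 0 ≤ u → C * ‖x‖ ^ τ * u ^ p ≤ f x u

/-- `u` solves `u(x) = ∫_{Ω_r} G_α(x,y) f(y,u(y)) dy` on the closure of `Ω_r`; that the integral
converges is part of the meaning of the equation. -/
def SolvesIE (n : ℕ) (α r c : ℝ) (f : EuclideanSpace ℝ (Fin n) → ℝ → ℝ)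
    (u : EuclideanSpace ℝ (Fin n) → ℝ) : Prop :=
  ∀ x ∈ closure (exteriorDomain n r),
    IntegrableOn (fun y => green n α r c x y * f y (u y)) (exteriorDomain n r) volume ∧
    u x = ∫ y in exteriorDomain n r, green n α r c x y * f y (u y)

end ExteriorLiouville

end

/-!
# Nonexistence of nontrivial solutions in exterior domains by the method of scaling spheres

Suppose `u` is a solution that does not vanish identically. Subcritical growth forces `f(x, v) > 0`
for `v > 0`, so the equation makes `u` positive in `Ω_r`.

For `R > r` let `u_R(x) = (R/|x|)^{n-α} u(R² x/|x|²)` be the Kelvin transform in the sphere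
`|x| = R`. The heart of the proof is that `u ≤ u_R` in `{r < |x| < R}` for *every* `R > r`
(`PositiveSolution.le_kelvin`). Folding the integral equation onto this shell by the inversion
(`setIntegral_foldedGain_le`) expresses `u_R - u` through four Green's functions. In the form
`G(x,y) = c r^{n-α} J(r²|x-y|², (|x|²-r²)(|y|²-r²))` with
`J(A,P) = ∫_0^P q^{α/2-1} (A+q)^{-n/2} dq` (`green_eq_kernelJ`), the required kernel inequalities
reduce to the monotonicity of `J` and of its increments (`green_reflect_right_le`,
`green_add_lt`). Together with the subcritical scaling inequality they give

* a strong maximum principle: `u ≤ u_R` in the shell implies `u < u_R` (`lt_kelvin_of_le`);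
* a narrow region principle: if `u ≤ u_R` outside a set of small measure, then it holds everywhere
  (`exists_narrow_principle`). Here the singularity `(|y|-r)^{-θ}`, `θ < α/n`, of the Lipschitz
  constant is paired with that of the kernel by Young's inequality
  (`exists_singular_integral_le`).

Hence the set of good radii, which contains the trivial radius `R = r`, is closed and open to the
right.

Letting the spheres vary, `u(z) ≥ k |z|^{-κ}` at infinity with `κ = (n-α)/2` (`exists_rpow_le`).
Inserting such a bound into the equation, restricted to dilated balls in the cone of (f₃), improves
`κ` to `pκ - (α+τ)`, and the convergence of the integral requires `pκ > α+τ`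
(`exists_le_setIntegral_ball`, `exponent_neg`). In the admissible range of `p` and `τ` these
exponents decrease by a fixed amount at each step while staying positive, which is absurd. The case
`α = n` is included throughout: the kernel bound `kernelJ_le` gives up an arbitrarily small power,
and at the last step `κ = 0` is already contradictory.
-/

namespace ExteriorLiouville

/-! ### The kernel as a homogeneous integral -/

/-- `J(A, P) = ∫_0^P q^{α/2-1} (A+q)^{-ν/2} dq`. With `ν = n`, the Green's function is
`c r^{n-α} J(r²|x-y|², (|x|²-r²)(|y|²-r²))`; unlike the original formula, this separates the
distance `|x-y|` from the distances to the sphere. -/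
noncomputable def kernelJ (ν α A P : ℝ) : ℝ :=
  ∫ q in (0 : ℝ)..P, q ^ (α / 2 - 1) / (A + q) ^ (ν / 2)

lemma kernelJ_intervalIntegrable {ν α A a b : ℝ} (hα : 0 < α) (hA : 0 < A) (ha : 0 ≤ a)
    (hb : 0 ≤ b) :
    IntervalIntegrable (fun q : ℝ => q ^ (α / 2 - 1) / (A + q) ^ (ν / 2)) volume a b := by
  simp only [div_eq_mul_inv]
  refine IntervalIntegrable.mul_continuousOn
    (intervalIntegral.intervalIntegrable_rpow' (by linarith)) ?_
  have hpos : ∀ q ∈ uIcc a b, 0 < A + q := fun q hq => by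
    have := (le_min ha hb).trans hq.1
    linarith
  refine ContinuousOn.inv₀ (ContinuousOn.rpow_const (by fun_prop) fun q hq => Or.inl
    (hpos q hq).ne') fun q hq => (Real.rpow_pos_of_pos (hpos q hq) _).ne'

lemma sq_rpow_half {x : ℝ} (hx : 0 ≤ x) (e : ℝ) : (x ^ 2) ^ (e / 2) = x ^ e := by
  rw [← Real.rpow_natCast, ← Real.rpow_mul hx]
  congr 1
  push_cast; ring

lemma kernelJ_scale {ν α A P k : ℝ} (hA : 0 < A) (hP : 0 ≤ P) (hk : 0 < k) :
    kernelJ ν α (k * A) (k * P) = k ^ ((α - ν) / 2) * kernelJ ν α A P := by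
  have h := intervalIntegral.smul_integral_comp_mul_left (a := 0) (b := P)
    (fun q : ℝ => q ^ (α / 2 - 1) / (k * A + q) ^ (ν / 2)) k
  rw [mul_zero] at h
  rw [kernelJ, ← h, kernelJ, smul_eq_mul, ← intervalIntegral.integral_const_mul,
    ← intervalIntegral.integral_const_mul]
  refine intervalIntegral.integral_congr fun q hq => ?_
  rw [uIcc_of_le hP] at hq
  have hAq : 0 < A + q := by linarith [hq.1]
  have e : k ^ ((α - ν) / 2) * k ^ (ν / 2) = k * k ^ (α / 2 - 1) := by
    rw [Real.rpow_sub_one hk.ne', ← Real.rpow_add hk]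
    field_simp
    congr 1
    ring
  have hkν := (Real.rpow_pos_of_pos hk (ν / 2)).ne'
  rw [← mul_add, Real.mul_rpow hk.le hq.1, Real.mul_rpow hk.le hAq.le, mul_div_mul_comm,
    ← mul_assoc]
  congr 1
  rw [← mul_div_assoc, ← e, mul_div_cancel_right₀ _ hkν]

lemma kernelJ_sub {ν α A P P' : ℝ} (hα : 0 < α) (hA : 0 < A) (hP : 0 ≤ P) (hP' : 0 ≤ P') :
    kernelJ ν α A P' - kernelJ ν α A P = ∫ q in P..P', q ^ (α / 2 - 1) / (A + q) ^ (ν / 2) :=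
  intervalIntegral.integral_interval_sub_left
    (kernelJ_intervalIntegrable hα hA le_rfl hP') (kernelJ_intervalIntegrable hα hA le_rfl hP)

lemma kernelJ_lt_kernelJ {ν α A P P' : ℝ} (hα : 0 < α) (hA : 0 < A) (hP : 0 ≤ P) (h : P < P') :
    kernelJ ν α A P < kernelJ ν α A P' := by
  rw [← sub_pos, kernelJ_sub hα hA hP (hP.trans h.le)]
  refine intervalIntegral.intervalIntegral_pos_of_pos_on
    (kernelJ_intervalIntegrable hα hA hP (hP.trans h.le)) (fun q hq => ?_) h
  have : 0 < q := hP.trans_lt hq.1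
  positivity

lemma kernelJ_mono {ν α A P P' : ℝ} (hα : 0 < α) (hA : 0 < A) (hP : 0 ≤ P) (h : P ≤ P') :
    kernelJ ν α A P ≤ kernelJ ν α A P' := by
  rcases h.eq_or_lt with rfl | h
  · rfl
  · exact (kernelJ_lt_kernelJ hα hA hP h).le

lemma kernelJ_pos {ν α A P : ℝ} (hα : 0 < α) (hA : 0 < A) (hP : 0 < P) : 0 < kernelJ ν α A P := by
  simpa [kernelJ] using kernelJ_lt_kernelJ (ν := ν) hα hA le_rfl hP

/-- The increments of `J` in the second variable are non-increasing in the first. -/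
lemma kernelJ_sub_anti {ν α A B P P' : ℝ} (hν : 0 ≤ ν) (hα : 0 < α) (hA : 0 < A) (hAB : A ≤ B)
    (hP : 0 ≤ P) (h : P ≤ P') :
    kernelJ ν α B P' - kernelJ ν α B P ≤ kernelJ ν α A P' - kernelJ ν α A P := by
  have hB := hA.trans_le hAB
  have hP' := hP.trans h
  rw [kernelJ_sub hα hA hP hP', kernelJ_sub hα hB hP hP']
  refine intervalIntegral.integral_mono_on h (kernelJ_intervalIntegrable hα hB hP hP')
    (kernelJ_intervalIntegrable hα hA hP hP') fun q hq => ?_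
  have hq0 : 0 ≤ q := hP.trans hq.1
  gcongr

lemma kernelJ_anti {ν α A B P : ℝ} (hν : 0 ≤ ν) (hα : 0 < α) (hA : 0 < A) (hAB : A ≤ B)
    (hP : 0 ≤ P) : kernelJ ν α B P ≤ kernelJ ν α A P := by
  simpa [kernelJ] using kernelJ_sub_anti hν hα hA hAB le_rfl hP

/-- Trading an arbitrarily small power of `A` for convergence makes this bound valid for `α = ν`
as well as for `α < ν`. -/
lemma kernelJ_le {ν α A P ε : ℝ} (hα : 0 < α) (hαν : α ≤ ν) (hA : 0 < A) (hP : 0 ≤ P)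
    (hε : 0 < ε) (hεα : ε ≤ α / 2) :
    kernelJ ν α A P ≤ A ^ (-((ν - α) / 2 + ε)) * (P ^ ε / ε) := by
  have hI : ∫ q in (0 : ℝ)..P, q ^ (ε - 1) = P ^ ε / ε := by
    rw [integral_rpow (Or.inl (by linarith))]
    simp [Real.zero_rpow hε.ne']
  rw [← hI, ← intervalIntegral.integral_const_mul]
  refine intervalIntegral.integral_mono_on_of_le_Ioo hP
    (kernelJ_intervalIntegrable hα hA le_rfl hP)
    ((intervalIntegral.intervalIntegrable_rpow' (by linarith)).const_mul _) fun q hq => ?_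
  have hq0 : 0 < q := hq.1
  have h1 : q ^ (α / 2 - 1) = q ^ (ε - 1) * q ^ (α / 2 - ε) := by
    rw [← Real.rpow_add hq0]; ring_nf
  have h2 : (A + q) ^ (ν / 2) = (A + q) ^ ((ν - α) / 2 + ε) * (A + q) ^ (α / 2 - ε) := by
    rw [← Real.rpow_add (by positivity)]; ring_nf
  have h3 : q ^ (α / 2 - ε) ≤ (A + q) ^ (α / 2 - ε) :=
    Real.rpow_le_rpow hq0.le (by linarith) (by linarith)
  have h4 : A ^ ((ν - α) / 2 + ε) ≤ (A + q) ^ ((ν - α) / 2 + ε) :=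
    Real.rpow_le_rpow hA.le (by linarith) (by linarith)
  rw [h1, h2, Real.rpow_neg hA.le, div_le_iff₀ (by positivity)]
  have h5 : 1 ≤ (A ^ ((ν - α) / 2 + ε))⁻¹ * (A + q) ^ ((ν - α) / 2 + ε) := by
    rw [inv_mul_eq_div, le_div_iff₀ (by positivity)]; simpa using h4
  calc q ^ (ε - 1) * q ^ (α / 2 - ε) = q ^ (ε - 1) * (1 * q ^ (α / 2 - ε)) := by ring
    _ ≤ q ^ (ε - 1) * (((A ^ ((ν - α) / 2 + ε))⁻¹ * (A + q) ^ ((ν - α) / 2 + ε)) *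
        (A + q) ^ (α / 2 - ε)) := by gcongr
    _ = _ := by ring

/-! ### The Green's function -/

section Green

variable {n : ℕ} {α r c : ℝ}

lemma green_eq_kernelJ (hr : 0 < r) {x y : EuclideanSpace ℝ (Fin n)}
    (hx : r < ‖x‖) (hy : r < ‖y‖) (hxy : x ≠ y) :
    green n α r c x y = c * r ^ ((n : ℝ) - α) *
      kernelJ n α (r ^ 2 * ‖x - y‖ ^ 2) ((‖x‖ ^ 2 - r ^ 2) * (‖y‖ ^ 2 - r ^ 2)) := by
  have hD : 0 < ‖x - y‖ := norm_pos_iff.2 (sub_ne_zero.2 hxy)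
  have ha : 0 < ‖x‖ ^ 2 - r ^ 2 := by nlinarith
  have hb : 0 < ‖y‖ ^ 2 - r ^ 2 := by nlinarith
  have hk : 0 < r ^ 2 * ‖x - y‖ ^ 2 := by positivity
  have h := kernelJ_scale (ν := n) (α := α) (A := 1)
    (P := (‖x‖ ^ 2 - r ^ 2) * (‖y‖ ^ 2 - r ^ 2) / (r ^ 2 * ‖x - y‖ ^ 2)) one_pos (by positivity) hk
  rw [mul_one, mul_div_cancel₀ _ hk.ne'] at h
  have e1 : (r ^ 2 * ‖x - y‖ ^ 2) ^ ((α - n) / 2)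
      = (r ^ ((n : ℝ) - α))⁻¹ * (‖x - y‖ ^ ((n : ℝ) - α))⁻¹ := by
    rw [← mul_pow, sq_rpow_half (by positivity), Real.mul_rpow hr.le hD.le, ← neg_sub (n : ℝ) α,
      Real.rpow_neg hr.le, Real.rpow_neg hD.le]
  rw [green, if_pos ⟨hx, hy⟩, h, e1, kernelJ]
  have := (Real.rpow_pos_of_pos hr ((n : ℝ) - α)).ne'
  field_simp

lemma green_comm (x y : EuclideanSpace ℝ (Fin n)) : green n α r c x y = green n α r c y x := by
  by_cases h : x ∈ exteriorDomain n r ∧ y ∈ exteriorDomain n r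
  · rw [green, green, norm_sub_rev, mul_comm (‖x‖ ^ 2 - r ^ 2), if_pos h, if_pos h.symm]
  · rw [green, green, if_neg h, if_neg (mt And.symm h)]

lemma green_pos (hα : 0 < α) (hr : 0 < r) (hc : 0 < c) {x y : EuclideanSpace ℝ (Fin n)}
    (hx : r < ‖x‖) (hy : r < ‖y‖) (hxy : x ≠ y) : 0 < green n α r c x y := by
  rw [green_eq_kernelJ hr hx hy hxy]
  have hD : 0 < ‖x - y‖ := norm_pos_iff.2 (sub_ne_zero.2 hxy)
  have ha : 0 < ‖x‖ ^ 2 - r ^ 2 := by nlinarith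
  have hb : 0 < ‖y‖ ^ 2 - r ^ 2 := by nlinarith
  have := kernelJ_pos (ν := n) hα (A := r ^ 2 * ‖x - y‖ ^ 2) (by positivity) (mul_pos ha hb)
  positivity

lemma green_self (x : EuclideanSpace ℝ (Fin n)) : green n α r c x x = 0 := by
  simp [green]

lemma green_nonneg (hα : 0 < α) (hr : 0 < r) (hc : 0 < c) (x y : EuclideanSpace ℝ (Fin n)) :
    0 ≤ green n α r c x y := by
  by_cases h : x ∈ exteriorDomain n r ∧ y ∈ exteriorDomain n r
  · by_cases hxy : x = y
    · rw [hxy, green_self]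
    · exact (green_pos hα hr hc h.1 h.2 hxy).le
  · rw [green, if_neg h]

/-- Far from a fixed ball, the Green's function decays no faster than the fundamental solution. -/
lemma exists_le_green (hα : 0 < α) (hr : 0 < r) (hc : 0 < c) :
    ∃ k : ℝ, 0 < k ∧ ∀ x y : EuclideanSpace ℝ (Fin n), 2 * r ≤ ‖x‖ → 2 * ‖x‖ ≤ ‖y‖ →
      k * ‖y‖ ^ (α - n) ≤ green n α r c x y := by
  refine ⟨c * r ^ ((n : ℝ) - α) * ((3 / 2 * r) ^ (α - n) * kernelJ n α 1 1), ?_, ?_⟩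
  · have := kernelJ_pos (ν := n) hα one_pos one_pos
    positivity
  intro x y hx hy
  have hx0 : 0 < ‖x‖ := by linarith
  have hy0 : 0 < ‖y‖ := by linarith
  have hxy : x ≠ y := by rintro rfl; linarith
  have hD : 0 < ‖x - y‖ := norm_pos_iff.2 (sub_ne_zero.2 hxy)
  have hD' : ‖x - y‖ ≤ 3 / 2 * ‖y‖ := (norm_sub_le x y).trans (by linarith)
  -- `k` separates `r²|x-y|²` from `(|x|²-r²)(|y|²-r²)`
  set k : ℝ := (3 / 2 * r * ‖y‖) ^ 2 with hk
  have hk0 : 0 < k := by positivity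
  have h1 : r ^ 2 * ‖x - y‖ ^ 2 ≤ k := by
    rw [← mul_pow]
    refine pow_le_pow_left₀ (by positivity) ?_ 2
    nlinarith
  have h2 : k ≤ (‖x‖ ^ 2 - r ^ 2) * (‖y‖ ^ 2 - r ^ 2) := by
    have ha : 3 * r ^ 2 ≤ ‖x‖ ^ 2 - r ^ 2 := by nlinarith
    have hb : 3 / 4 * ‖y‖ ^ 2 ≤ ‖y‖ ^ 2 - r ^ 2 := by nlinarith
    calc k = (3 * r ^ 2) * (3 / 4 * ‖y‖ ^ 2) := by rw [hk]; ring
      _ ≤ _ := by gcongr; nlinarith [sq_nonneg r]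
  have h3 : (3 / 2 * r) ^ (α - n) * ‖y‖ ^ (α - n) = k ^ ((α - n) / 2) := by
    rw [← Real.mul_rpow (by positivity) hy0.le, hk, sq_rpow_half (by positivity)]
  rw [green_eq_kernelJ hr (by linarith) (by linarith) hxy, mul_assoc, mul_right_comm _ _ (‖y‖ ^ _),
    h3]
  gcongr
  rw [← kernelJ_scale one_pos zero_le_one hk0, mul_one]
  exact (kernelJ_anti (by positivity) hα (by positivity) h1 hk0.le).trans
    (kernelJ_mono hα (by positivity) hk0.le h2)

end Green

/-! ### Reflection in a sphere and the reflected kernels -/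

section Reflect

variable {n : ℕ} {α r c R : ℝ} {x y : EuclideanSpace ℝ (Fin n)}

/-- The inversion `x ↦ R² x / |x|²` in the sphere `|x| = R`. -/
noncomputable def reflect (R : ℝ) (x : EuclideanSpace ℝ (Fin n)) : EuclideanSpace ℝ (Fin n) :=
  (R / ‖x‖) ^ 2 • x

lemma reflect_eq_inversion (R : ℝ) :
    (reflect R : EuclideanSpace ℝ (Fin n) → _) = EuclideanGeometry.inversion 0 R := by
  ext1 x
  simp [reflect, EuclideanGeometry.inversion]

lemma reflect_reflect (hR : R ≠ 0) (x : EuclideanSpace ℝ (Fin n)) :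
    reflect R (reflect R x) = x := by
  simp only [reflect_eq_inversion, EuclideanGeometry.inversion_inversion _ hR]

lemma norm_reflect (R : ℝ) (x : EuclideanSpace ℝ (Fin n)) : ‖reflect R x‖ = R ^ 2 / ‖x‖ := by
  rcases eq_or_ne x 0 with rfl | hx
  · simp [reflect]
  · have := norm_ne_zero_iff.2 hx
    rw [reflect, norm_smul, Real.norm_of_nonneg (by positivity)]
    field_simp

/-- `|x|² |x^R - y|² / R²`, where `x^R` is the reflection of `x` in the sphere `|x| = R`; this
expression is symmetric in `x` and `y`. -/
noncomputable def reflDistSq (R : ℝ) (x y : EuclideanSpace ℝ (Fin n)) : ℝ :=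
  R ^ 2 - 2 * inner ℝ x y + ‖x‖ ^ 2 * ‖y‖ ^ 2 / R ^ 2

/-- `|x|² (|x^R|² - r²) / R²`, where `x^R` is the reflection of `x` in the sphere `|x| = R`. -/
noncomputable def reflGap (r R : ℝ) (x : EuclideanSpace ℝ (Fin n)) : ℝ :=
  R ^ 2 - r ^ 2 * ‖x‖ ^ 2 / R ^ 2

lemma reflDistSq_comm (R : ℝ) (x y : EuclideanSpace ℝ (Fin n)) :
    reflDistSq R x y = reflDistSq R y x := by
  rw [reflDistSq, reflDistSq, real_inner_comm, mul_comm (‖x‖ ^ 2)]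

lemma norm_reflect_sub_sq (hR : R ≠ 0) (hx : x ≠ 0) :
    ‖reflect R x - y‖ ^ 2 = (R / ‖x‖) ^ 2 * reflDistSq R x y := by
  have := norm_ne_zero_iff.2 hx
  rw [norm_sub_sq_real, norm_reflect, reflect, real_inner_smul_left, reflDistSq]
  field_simp

lemma norm_reflect_sub_reflect_sq (hx : x ≠ 0) (hy : y ≠ 0) :
    ‖reflect R x - reflect R y‖ ^ 2 = (R / ‖x‖) ^ 2 * (R / ‖y‖) ^ 2 * ‖x - y‖ ^ 2 := by
  have := norm_ne_zero_iff.2 hx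
  have := norm_ne_zero_iff.2 hy
  rw [norm_sub_sq_real, norm_sub_sq_real, norm_reflect, norm_reflect, reflect, reflect,
    real_inner_smul_left, real_inner_smul_right]
  field_simp
  ring

lemma reflDistSq_sub (hR : R ≠ 0) :
    reflDistSq R x y - ‖x - y‖ ^ 2 = (R ^ 2 - ‖x‖ ^ 2) * (R ^ 2 - ‖y‖ ^ 2) / R ^ 2 := by
  rw [norm_sub_sq_real, reflDistSq]
  field_simp
  ring

lemma norm_reflect_sq_sub (hR : R ≠ 0) (hx : x ≠ 0) :
    ‖reflect R x‖ ^ 2 - r ^ 2 = (R / ‖x‖) ^ 2 * reflGap r R x := by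
  have := norm_ne_zero_iff.2 hx
  rw [norm_reflect, reflGap]
  field_simp

lemma reflGap_sub (hR : R ≠ 0) :
    reflGap r R x - (‖x‖ ^ 2 - r ^ 2) = (1 + r ^ 2 / R ^ 2) * (R ^ 2 - ‖x‖ ^ 2) := by
  rw [reflGap]
  field_simp
  ring

lemma gap_lt_reflGap (hx : ‖x‖ < R) : ‖x‖ ^ 2 - r ^ 2 < reflGap r R x := by
  have hR : 0 < R := (norm_nonneg x).trans_lt hx
  rw [← sub_pos, reflGap_sub hR.ne']
  have : 0 < R ^ 2 - ‖x‖ ^ 2 := by nlinarith [norm_nonneg x]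
  positivity

lemma gap_pos (hr : 0 < r) (hx : r < ‖x‖) : 0 < ‖x‖ ^ 2 - r ^ 2 := by nlinarith

lemma lt_norm_reflect (hr : 0 < r) (hx : r < ‖x‖) (hxR : ‖x‖ < R) : R < ‖reflect R x‖ := by
  rw [norm_reflect, lt_div_iff₀ (hr.trans hx)]
  nlinarith [hr.trans hx]

lemma norm_reflect_lt (hr : 0 < r) (hR : 0 < R) (hx : r < ‖x‖) : ‖reflect R x‖ < R ^ 2 / r := by
  rw [norm_reflect]
  gcongr

lemma green_reflect_left (hr : 0 < r) (hx : r < ‖x‖) (hxR : ‖x‖ < R) (hy : r < ‖y‖)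
    (hne : reflect R x ≠ y) :
    (R / ‖x‖) ^ ((n : ℝ) - α) * green n α r c (reflect R x) y =
      c * r ^ ((n : ℝ) - α) *
        kernelJ n α (r ^ 2 * reflDistSq R x y) (reflGap r R x * (‖y‖ ^ 2 - r ^ 2)) := by
  have hx0 : 0 < ‖x‖ := hr.trans hx
  have hR : 0 < R := hx0.trans hxR
  have hk : 0 < R / ‖x‖ := by positivity
  have hD : 0 < ‖reflect R x - y‖ ^ 2 := by
    have := norm_pos_iff.2 (sub_ne_zero.2 hne)
    positivity
  rw [green_eq_kernelJ hr (hx.trans (hxR.trans (lt_norm_reflect hr hx hxR))) hy hne]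
  rw [norm_reflect_sub_sq hR.ne' (norm_pos_iff.1 hx0)] at hD ⊢
  rw [norm_reflect_sq_sub hR.ne' (norm_pos_iff.1 hx0), mul_left_comm (r ^ 2),
    mul_assoc ((R / ‖x‖) ^ 2),
    kernelJ_scale (mul_pos (by positivity) (pos_of_mul_pos_right hD (by positivity)))
      (mul_nonneg ((gap_pos hr hx).trans (gap_lt_reflGap hxR)).le (gap_pos hr hy).le)
      (by positivity), sq_rpow_half hk.le, ← neg_sub (n : ℝ) α, Real.rpow_neg hk.le]
  have := (Real.rpow_pos_of_pos hk ((n : ℝ) - α)).ne'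
  field_simp

lemma reflect_ne_of_norm_lt (hr : 0 < r) (hx : r < ‖x‖) (hxR : ‖x‖ < R) (hyR : ‖y‖ < R) :
    reflect R x ≠ y := by
  rintro rfl
  exact hyR.not_gt (lt_norm_reflect hr hx hxR)

lemma green_reflect_right (hr : 0 < r) (hx : r < ‖x‖) (hy : r < ‖y‖) (hyR : ‖y‖ < R)
    (hne : reflect R y ≠ x) :
    (R / ‖y‖) ^ ((n : ℝ) - α) * green n α r c x (reflect R y) =
      c * r ^ ((n : ℝ) - α) *
        kernelJ n α (r ^ 2 * reflDistSq R x y) ((‖x‖ ^ 2 - r ^ 2) * reflGap r R y) := by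
  rw [green_comm, green_reflect_left hr hy hyR hx hne, reflDistSq_comm, mul_comm (reflGap _ _ _)]

lemma green_reflect_both (hr : 0 < r) (hx : r < ‖x‖) (hxR : ‖x‖ < R) (hy : r < ‖y‖)
    (hyR : ‖y‖ < R) (hne : x ≠ y) :
    (R / ‖y‖) ^ ((n : ℝ) - α) * ((R / ‖x‖) ^ ((n : ℝ) - α) *
      green n α r c (reflect R x) (reflect R y)) =
      c * r ^ ((n : ℝ) - α) *
        kernelJ n α (r ^ 2 * ‖x - y‖ ^ 2) (reflGap r R x * reflGap r R y) := by
  have hx0 : 0 < ‖x‖ := hr.trans hx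
  have hy0 : 0 < ‖y‖ := hr.trans hy
  have hR : 0 < R := hx0.trans hxR
  have hk : 0 < R / ‖x‖ := by positivity
  have hk' : 0 < R / ‖y‖ := by positivity
  have hne' : reflect R x ≠ reflect R y := fun h => hne <| by
    rw [← reflect_reflect hR.ne' x, h, reflect_reflect hR.ne']
  have hD := norm_pos_iff.2 (sub_ne_zero.2 hne)
  have e1 : r ^ 2 * ((R / ‖x‖) ^ 2 * (R / ‖y‖) ^ 2 * ‖x - y‖ ^ 2)
      = (R / ‖x‖ * (R / ‖y‖)) ^ 2 * (r ^ 2 * ‖x - y‖ ^ 2) := by ring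
  have e2 : (R / ‖x‖) ^ 2 * reflGap r R x * ((R / ‖y‖) ^ 2 * reflGap r R y)
      = (R / ‖x‖ * (R / ‖y‖)) ^ 2 * (reflGap r R x * reflGap r R y) := by ring
  rw [green_eq_kernelJ hr (hx.trans (hxR.trans (lt_norm_reflect hr hx hxR)))
      (hy.trans (hyR.trans (lt_norm_reflect hr hy hyR))) hne',
    norm_reflect_sub_reflect_sq (norm_pos_iff.1 hx0) (norm_pos_iff.1 hy0),
    norm_reflect_sq_sub hR.ne' (norm_pos_iff.1 hx0),
    norm_reflect_sq_sub hR.ne' (norm_pos_iff.1 hy0), e1, e2,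
    kernelJ_scale (by positivity)
      (mul_nonneg ((gap_pos hr hx).trans (gap_lt_reflGap hxR)).le
        ((gap_pos hr hy).trans (gap_lt_reflGap hyR)).le)
      (by positivity), sq_rpow_half (by positivity), ← neg_sub (n : ℝ) α,
      Real.rpow_neg (by positivity), Real.mul_rpow hk.le hk'.le]
  have := (Real.rpow_pos_of_pos hk ((n : ℝ) - α)).ne'
  have := (Real.rpow_pos_of_pos hk' ((n : ℝ) - α)).ne'
  field_simp

lemma norm_sub_sq_lt_reflDistSq (hx : ‖x‖ < R) (hy : ‖y‖ < R) :
    ‖x - y‖ ^ 2 < reflDistSq R x y := by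
  have hR : 0 < R := (norm_nonneg x).trans_lt hx
  rw [← sub_pos, reflDistSq_sub hR.ne']
  have : 0 < R ^ 2 - ‖x‖ ^ 2 := by nlinarith [norm_nonneg x]
  have : 0 < R ^ 2 - ‖y‖ ^ 2 := by nlinarith [norm_nonneg y]
  positivity

/-- For `y` outside the sphere, moving `x` from inside the sphere to its reflection increases the
suitably weighted Green's function. -/
lemma green_le_green_reflect_left (hα : 0 < α) (hr : 0 < r) (hc : 0 < c) (hx : r < ‖x‖)
    (hxR : ‖x‖ < R) (hy : R ≤ ‖y‖) (hne : reflect R x ≠ y) :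
    green n α r c x y ≤ (R / ‖x‖) ^ ((n : ℝ) - α) * green n α r c (reflect R x) y := by
  have hx0 : 0 < ‖x‖ := hr.trans hx
  have hR : 0 < R := hx0.trans hxR
  have hry : r < ‖y‖ := hx.trans (hxR.trans_le hy)
  have hxy : x ≠ y := by rintro rfl; linarith
  have hD := norm_pos_iff.2 (sub_ne_zero.2 hxy)
  have hd : 0 < reflDistSq R x y := by
    have h := norm_pos_iff.2 (sub_ne_zero.2 hne)
    have h2 : 0 < ‖reflect R x - y‖ ^ 2 := by positivity
    rw [norm_reflect_sub_sq hR.ne' (norm_pos_iff.1 hx0)] at h2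
    exact pos_of_mul_pos_right h2 (by positivity)
  have hdD : reflDistSq R x y ≤ ‖x - y‖ ^ 2 := by
    rw [← sub_nonpos, reflDistSq_sub hR.ne']
    have : 0 < R ^ 2 - ‖x‖ ^ 2 := by nlinarith
    have : R ^ 2 - ‖y‖ ^ 2 ≤ 0 := by nlinarith
    exact div_nonpos_of_nonpos_of_nonneg (mul_nonpos_of_nonneg_of_nonpos (by linarith) this)
      (by positivity)
  have ha := gap_pos hr hx
  have hb := gap_pos hr hry
  rw [green_eq_kernelJ hr hx hry hxy, green_reflect_left hr hx hxR hry hne]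
  gcongr
  exact (kernelJ_anti (by positivity) hα (by positivity) (by gcongr) (by positivity)).trans
    (kernelJ_mono hα (by positivity) (by positivity)
      (mul_le_mul_of_nonneg_right (gap_lt_reflGap hxR).le hb.le))

/-- The kernel against the reflected source dominates the reflected kernel. -/
lemma green_reflect_right_le (hα : 0 < α) (hr : 0 < r) (hc : 0 < c) (hx : r < ‖x‖)
    (hxR : ‖x‖ < R) (hy : r < ‖y‖) (hyR : ‖y‖ < R) (hne : x ≠ y) :
    (R / ‖y‖) ^ ((n : ℝ) - α) * green n α r c x (reflect R y) ≤
      (R / ‖y‖) ^ ((n : ℝ) - α) * ((R / ‖x‖) ^ ((n : ℝ) - α) *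
        green n α r c (reflect R x) (reflect R y)) := by
  have hD := norm_pos_iff.2 (sub_ne_zero.2 hne)
  have hdD := norm_sub_sq_lt_reflDistSq hxR hyR
  have hd : 0 < reflDistSq R x y := lt_trans (by positivity) hdD
  have ha := gap_pos hr hx
  have hb := (gap_pos hr hy).trans (gap_lt_reflGap hyR)
  rw [green_reflect_right hr hx hy hyR (reflect_ne_of_norm_lt hr hy hyR hxR),
    green_reflect_both hr hx hxR hy hyR hne]
  gcongr
  exact (kernelJ_anti (by positivity) hα (by positivity) (by gcongr) (by positivity)).trans
    (kernelJ_mono hα (by positivity) (by positivity)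
      (mul_le_mul_of_nonneg_right (gap_lt_reflGap hxR).le hb.le))

/-- The total gain of the kernel under reflection is positive. With `a < a'`, `b < b'` the gaps of
`x`, `y` and their reflections, and `D < d` the two distances, this splits into
`[J(D,a'b') - J(D,ab)] - [J(d,a'b') - J(d,ab)] ≥ 0` and the monotonicity of `J(d,·)`. -/
lemma green_add_lt (hα : 0 < α) (hr : 0 < r) (hc : 0 < c) (hx : r < ‖x‖)
    (hxR : ‖x‖ < R) (hy : r < ‖y‖) (hyR : ‖y‖ < R) (hne : x ≠ y) :
    green n α r c x y + (R / ‖y‖) ^ ((n : ℝ) - α) * green n α r c x (reflect R y) <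
      (R / ‖x‖) ^ ((n : ℝ) - α) * green n α r c (reflect R x) y +
      (R / ‖y‖) ^ ((n : ℝ) - α) * ((R / ‖x‖) ^ ((n : ℝ) - α) *
        green n α r c (reflect R x) (reflect R y)) := by
  have hD := norm_pos_iff.2 (sub_ne_zero.2 hne)
  have hdD := norm_sub_sq_lt_reflDistSq hxR hyR
  have hd : 0 < reflDistSq R x y := lt_trans (by positivity) hdD
  have ha := gap_pos hr hx
  have ha' := gap_lt_reflGap (r := r) hxR
  have hb := gap_pos hr hy
  have hb' := gap_lt_reflGap (r := r) hyR
  have ha0 := ha.trans ha'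
  have hb0 := hb.trans hb'
  rw [green_reflect_right hr hx hy hyR (reflect_ne_of_norm_lt hr hy hyR hxR),
    green_reflect_both hr hx hxR hy hyR hne, green_eq_kernelJ hr hx hy hne,
    green_reflect_left hr hx hxR hy (reflect_ne_of_norm_lt hr hx hxR hyR), ← mul_add, ← mul_add]
  gcongr c * _ * ?_
  have h1 := kernelJ_sub_anti (ν := n) (by positivity) hα (A := r ^ 2 * ‖x - y‖ ^ 2)
    (B := r ^ 2 * reflDistSq R x y) (by positivity) (by gcongr) (mul_pos ha hb).le
    (mul_le_mul ha'.le hb'.le hb.le ha0.le)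
  have h2 := kernelJ_lt_kernelJ (ν := n) hα (A := r ^ 2 * reflDistSq R x y) (by positivity)
    (mul_pos ha hb0).le (mul_lt_mul_of_pos_right ha' hb0)
  have h3 := kernelJ_lt_kernelJ (ν := n) hα (A := r ^ 2 * reflDistSq R x y) (by positivity)
    (mul_pos ha hb).le (mul_lt_mul_of_pos_right ha' hb)
  linarith

/-- A bound for the doubly reflected kernel, uniform over bounded radii. -/
lemma exists_green_reflect_both_le (hα : 0 < α) (hαn : α ≤ n) (hr : 0 < r) (hc : 0 < c)
    (S : ℝ) {ε : ℝ} (hε : 0 < ε) (hεα : ε ≤ α / 2) :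
    ∃ k : ℝ, 0 ≤ k ∧ ∀ R ≤ S, ∀ x y : EuclideanSpace ℝ (Fin n), r < ‖x‖ → ‖x‖ < R → r < ‖y‖ →
      ‖y‖ < R → x ≠ y →
      (R / ‖y‖) ^ ((n : ℝ) - α) * ((R / ‖x‖) ^ ((n : ℝ) - α) *
        green n α r c (reflect R x) (reflect R y)) ≤ k * ‖x - y‖ ^ (-((n : ℝ) - α + 2 * ε)) := by
  refine ⟨c * r ^ ((n : ℝ) - α) * (r ^ (-((n : ℝ) - α + 2 * ε)) * ((S ^ 2 * S ^ 2) ^ ε / ε)),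
    by positivity, fun R hRS x y hx hxR hy hyR hne => ?_⟩
  have hD := norm_pos_iff.2 (sub_ne_zero.2 hne)
  have hR : 0 < R := hr.trans (hx.trans hxR)
  have ha0 := (gap_pos hr hx).trans (gap_lt_reflGap hxR)
  have hb0 := (gap_pos hr hy).trans (gap_lt_reflGap hyR)
  have hle : ∀ z : EuclideanSpace ℝ (Fin n), reflGap r R z ≤ S ^ 2 := fun z => by
    have : 0 ≤ r ^ 2 * ‖z‖ ^ 2 / R ^ 2 := by positivity
    rw [reflGap]
    nlinarith
  rw [green_reflect_both hr hx hxR hy hyR hne, mul_assoc (c * _)]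
  gcongr
  refine (kernelJ_le hα hαn (by positivity) (mul_pos ha0 hb0).le hε hεα).trans ?_
  have e : -(((n : ℝ) - α) / 2 + ε) = -((n : ℝ) - α + 2 * ε) / 2 := by ring
  rw [e, ← mul_pow, sq_rpow_half (by positivity), Real.mul_rpow hr.le hD.le, mul_right_comm]
  have := hle x
  have := hle y
  gcongr

end Reflect

/-! ### The integral inequality for the reflected function -/

section IntegralInequality

variable {n : ℕ} {α r c R : ℝ}

/-- The spherical shell `{r < |y| < R}`. -/
def shell (n : ℕ) (r R : ℝ) : Set (EuclideanSpace ℝ (Fin n)) := {y | r < ‖y‖ ∧ ‖y‖ < R}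

lemma isOpen_shell (n : ℕ) (r R : ℝ) : IsOpen (shell n r R) :=
  (isOpen_lt continuous_const continuous_norm).inter (isOpen_lt continuous_norm continuous_const)

lemma isOpen_exteriorDomain (n : ℕ) (r : ℝ) : IsOpen (exteriorDomain n r) :=
  isOpen_lt continuous_const continuous_norm

lemma shell_subset_exteriorDomain {s : ℝ} (h : r ≤ s) : shell n s R ⊆ exteriorDomain n r :=
  fun _ hy => h.trans_lt hy.1

lemma image_reflect_shell (hr : 0 < r) (hrR : r < R) :
    reflect R '' shell n r R = shell n R (R ^ 2 / r) := by
  have hR := hr.trans hrR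
  ext z
  constructor
  · rintro ⟨y, hy, rfl⟩
    exact ⟨lt_norm_reflect hr hy.1 hy.2, norm_reflect_lt hr hR hy.1⟩
  · intro hz
    have hz0 : 0 < ‖z‖ := hR.trans hz.1
    refine ⟨reflect R z, ⟨?_, ?_⟩, reflect_reflect hR.ne' z⟩
    · rw [norm_reflect, lt_div_iff₀ hz0, ← lt_div_iff₀' hr]
      exact hz.2
    · rw [norm_reflect, div_lt_iff₀ hz0]
      nlinarith [hz.1]

lemma hasFDerivAt_reflect {y : EuclideanSpace ℝ (Fin n)} (hy : y ≠ 0) :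
    ∃ f' : EuclideanSpace ℝ (Fin n) →L[ℝ] EuclideanSpace ℝ (Fin n),
      HasFDerivAt (reflect R) f' y ∧ |f'.det| = (R / ‖y‖) ^ (2 * n) := by
  refine ⟨_, reflect_eq_inversion R ▸ EuclideanGeometry.hasFDerivAt_inversion hy, ?_⟩
  have h : (((R / dist y 0) ^ 2 •
      ((ℝ ∙ (y - 0))ᗮ.reflection : EuclideanSpace ℝ (Fin n) →L[ℝ] EuclideanSpace ℝ (Fin n)))).det
      = ((R / dist y 0) ^ 2) ^ n * LinearMap.det (ℝ ∙ (y - 0))ᗮ.reflection.toLinearMap := by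
    rw [ContinuousLinearMap.det, ContinuousLinearMap.toLinearMap_smul, LinearMap.det_smul,
      finrank_euclideanSpace_fin]
    rfl
  rw [h, Submodule.det_reflection, abs_mul, abs_neg_one_pow, mul_one, dist_zero_right, ← pow_mul,
    abs_of_nonneg (by rw [pow_mul]; positivity)]

/-- Change of variables under the inversion, which maps `{r < |y| < R}` onto
`{R < |y| < R²/r}` and has Jacobian `(R/|y|)^{2n}`. -/
lemma setIntegral_shell_reflect (hr : 0 < r) (hrR : r < R) {g : EuclideanSpace ℝ (Fin n) → ℝ}
    (hg : IntegrableOn g (shell n R (R ^ 2 / r))) :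
    IntegrableOn (fun y => (R / ‖y‖) ^ (2 * n) * g (reflect R y)) (shell n r R) ∧
      ∫ y in shell n R (R ^ 2 / r), g y =
        ∫ y in shell n r R, (R / ‖y‖) ^ (2 * n) * g (reflect R y) := by
  have hR := hr.trans hrR
  have hne : ∀ y ∈ shell n r R, y ≠ 0 := fun y hy => norm_pos_iff.1 (hr.trans hy.1)
  choose! f' hf' hdet using fun y (hy : y ≠ 0) => hasFDerivAt_reflect (R := R) hy
  have hm := (isOpen_shell n r R).measurableSet
  have hinj : InjOn (reflect R) (shell n r R) :=
    (Function.LeftInverse.injective (reflect_reflect hR.ne')).injOn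
  have hder : ∀ y ∈ shell n r R, HasFDerivWithinAt (reflect R) (f' y) (shell n r R) y :=
    fun y hy => (hf' y (hne y hy)).hasFDerivWithinAt
  have hcongr : EqOn (fun y => |(f' y).det| • g (reflect R y))
      (fun y => (R / ‖y‖) ^ (2 * n) * g (reflect R y)) (shell n r R) := fun y hy => by
    simp only [hdet y (hne y hy), smul_eq_mul]
  rw [← image_reflect_shell hr hrR] at hg ⊢
  constructor
  · rw [← integrableOn_congr_fun hcongr hm]
    exact (integrableOn_image_iff_integrableOn_abs_det_fderiv_smul _ hm hder hinj g).1 hg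
  · rw [integral_image_eq_integral_abs_det_fderiv_smul _ hm hder hinj g]
    exact setIntegral_congr_fun hm hcongr

/-- The integrand that remains after folding `u_R - u` onto the shell `{r < |y| < R}`. -/
noncomputable def foldedGain (n : ℕ) (α r c R : ℝ) (F : EuclideanSpace ℝ (Fin n) → ℝ)
    (x y : EuclideanSpace ℝ (Fin n)) : ℝ :=
  ((R / ‖x‖) ^ ((n : ℝ) - α) * green n α r c (reflect R x) y - green n α r c x y) * F y +
    (R / ‖y‖) ^ (2 * n) * (((R / ‖x‖) ^ ((n : ℝ) - α) *
      green n α r c (reflect R x) (reflect R y) - green n α r c x (reflect R y)) * F (reflect R y))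

/-- The part of the integral over `|y| = R` and `|y| ≥ R²/r` is non-negative, so only the shell
`{r < |y| < R}` and its reflection matter. -/
lemma setIntegral_foldedGain_le (hα : 0 < α) (hr : 0 < r) (hc : 0 < c)
    {F : EuclideanSpace ℝ (Fin n) → ℝ} (hF : ∀ y ∈ exteriorDomain n r, 0 ≤ F y)
    {x : EuclideanSpace ℝ (Fin n)} (hx : x ∈ shell n r R)
    (h1 : IntegrableOn (fun y => green n α r c x y * F y) (exteriorDomain n r))
    (h2 : IntegrableOn (fun y => green n α r c (reflect R x) y * F y) (exteriorDomain n r)) :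
    IntegrableOn (foldedGain n α r c R F x) (shell n r R) ∧
      ∫ y in shell n r R, foldedGain n α r c R F x y ≤
        (R / ‖x‖) ^ ((n : ℝ) - α) *
          (∫ y in exteriorDomain n r, green n α r c (reflect R x) y * F y) -
        ∫ y in exteriorDomain n r, green n α r c x y * F y := by
  have hrR := hx.1.trans hx.2
  have hR := hr.trans hrR
  set H : EuclideanSpace ℝ (Fin n) → ℝ := fun y =>
    ((R / ‖x‖) ^ ((n : ℝ) - α) * green n α r c (reflect R x) y - green n α r c x y) * F y with hH
  have hH' : H = fun y => (R / ‖x‖) ^ ((n : ℝ) - α) * (green n α r c (reflect R x) y * F y) -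
      green n α r c x y * F y := by
    ext y; simp only [hH]; ring
  have hHi : IntegrableOn H (exteriorDomain n r) := hH' ▸ (h2.const_mul _).sub h1
  have hHint : ∫ y in exteriorDomain n r, H y = (R / ‖x‖) ^ ((n : ℝ) - α) *
          (∫ y in exteriorDomain n r, green n α r c (reflect R x) y * F y) -
        ∫ y in exteriorDomain n r, green n α r c x y * F y := by
    rw [hH', integral_sub (h2.const_mul _) h1, integral_const_mul]
  have hs1 : shell n r R ⊆ exteriorDomain n r := shell_subset_exteriorDomain le_rfl
  have hs2 : shell n R (R ^ 2 / r) ⊆ exteriorDomain n r := shell_subset_exteriorDomain hrR.le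
  have hm1 := (isOpen_shell n r R).measurableSet
  have hm2 := (isOpen_shell n R (R ^ 2 / r)).measurableSet
  have hm := (isOpen_exteriorDomain n r).measurableSet
  obtain ⟨hi, he⟩ := setIntegral_shell_reflect hr hrR (hHi.mono_set hs2)
  refine ⟨(hHi.mono_set hs1).add hi, ?_⟩
  have hdisj : Disjoint (shell n r R) (shell n R (R ^ 2 / r)) :=
    Set.disjoint_left.2 fun y hy hy' => hy.2.not_gt hy'.1
  have hu := setIntegral_union hdisj hm2 (hHi.mono_set hs1) (hHi.mono_set hs2)
  have hd := setIntegral_sdiff (hm1.union hm2) hHi (union_subset hs1 hs2)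
  have hnn : 0 ≤ ∫ y in exteriorDomain n r \ (shell n r R ∪ shell n R (R ^ 2 / r)), H y := by
    refine setIntegral_nonneg (hm.diff (hm1.union hm2)) fun y hy => ?_
    have hyR : R ≤ ‖y‖ := not_lt.1 fun h => hy.2 (Or.inl ⟨hy.1, h⟩)
    have hne : reflect R x ≠ y := by
      rintro rfl
      exact hy.2 (Or.inr ⟨lt_norm_reflect hr hx.1 hx.2, norm_reflect_lt hr hR hx.1⟩)
    exact mul_nonneg
      (sub_nonneg.2 (green_le_green_reflect_left hα hr hc hx.1 hx.2 hyR hne)) (hF y hy.1)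
  have hsum : ∫ y in shell n r R, foldedGain n α r c R F x y =
      (∫ y in shell n r R, H y) +
        ∫ y in shell n r R, (R / ‖y‖) ^ (2 * n) * H (reflect R y) :=
    integral_add (hHi.mono_set hs1) hi
  rw [hsum, ← he, ← hHint, ← hu]
  linarith

end IntegralInequality

/-! ### Smallness of singular integrals over thin sets -/

section Smallness

variable {n : ℕ}

lemma integrableOn_shell_of_radial (hn : 0 < n) {a b : ℝ} {g : ℝ → ℝ}
    (hg : IntegrableOn (fun s => s ^ (n - 1) * g s) (Ioo a b)) :
    IntegrableOn (fun y : EuclideanSpace ℝ (Fin n) => g ‖y‖) (shell n a b) := by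
  have : Nontrivial (EuclideanSpace ℝ (Fin n)) :=
    Module.nontrivial_of_finrank_pos (R := ℝ) (by rwa [finrank_euclideanSpace_fin])
  have h := (integrable_fun_norm_addHaar (volume : Measure (EuclideanSpace ℝ (Fin n)))
    (f := (Ioo a b).indicator g)).2 (by
      rw [finrank_euclideanSpace_fin]
      have e : (fun y : ℝ => y ^ (n - 1) • (Ioo a b).indicator g y) =
          (Ioo a b).indicator (fun s => s ^ (n - 1) * g s) := by
        ext y
        by_cases hy : y ∈ Ioo a b <;> simp [hy]
      rw [e]
      exact (IntegrableOn.integrable_indicator hg measurableSet_Ioo).integrableOn)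
  rw [← integrable_indicator_iff (isOpen_shell n a b).measurableSet]
  exact h

/-- The function `|z|^{-γ}`, cut off to `{0 < |z| < T}`. -/
noncomputable def cutPower (n : ℕ) (γ T : ℝ) : EuclideanSpace ℝ (Fin n) → ℝ :=
  (shell n 0 T).indicator fun z => ‖z‖ ^ (-γ)

/-- The function `(|y| - r)^{-q}`, cut off to `{r < |y| < S}`. -/
noncomputable def cutSpherePower (n : ℕ) (r q S : ℝ) : EuclideanSpace ℝ (Fin n) → ℝ :=
  (shell n r S).indicator fun y => (‖y‖ - r) ^ (-q)

lemma cutPower_nonneg (γ T : ℝ) (z : EuclideanSpace ℝ (Fin n)) : 0 ≤ cutPower n γ T z :=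
  indicator_nonneg (fun _ _ => by positivity) z

lemma cutSpherePower_nonneg (r q S : ℝ) (y : EuclideanSpace ℝ (Fin n)) :
    0 ≤ cutSpherePower n r q S y :=
  indicator_nonneg (fun _ hy => Real.rpow_nonneg (sub_nonneg.2 hy.1.le) _) y

lemma integrableOn_Ioo_sub_rpow {r q S : ℝ} (hq : q < 1) :
    IntegrableOn (fun s : ℝ => (s - r) ^ (-q)) (Ioo r S) := by
  rcases le_total r S with h | h
  · have h1 := (intervalIntegral.intervalIntegrable_rpow' (a := 0) (b := S - r) (r := -q)
      (by linarith)).comp_sub_right r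
    rw [zero_add, sub_add_cancel, intervalIntegrable_iff_integrableOn_Ioo_of_le h] at h1
    exact h1
  · rw [Ioo_eq_empty h.not_gt]
    exact integrableOn_empty

lemma integrable_cutPower (hn : 0 < n) {γ : ℝ} (hγ : γ < n) (T : ℝ) :
    Integrable (cutPower n γ T) := by
  have key : ∀ e : ℝ, -1 < e → IntegrableOn (fun s : ℝ => s ^ e) (Ioo 0 T) := fun e he => by
    simpa using integrableOn_Ioo_sub_rpow (r := 0) (S := T) (q := -e) (by linarith)
  rw [cutPower, integrable_indicator_iff (isOpen_shell n 0 T).measurableSet]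
  refine integrableOn_shell_of_radial hn (g := fun s => s ^ (-γ)) ((integrableOn_congr_fun (fun y hy => ?_)
    measurableSet_Ioo).1 (key ((n : ℝ) - 1 - γ) (by linarith)))
  rw [← Real.rpow_natCast, ← Real.rpow_add hy.1, Nat.cast_sub (by omega)]
  congr 1
  push_cast; ring

lemma integrable_cutSpherePower (hn : 0 < n) {r q : ℝ} (hq : q < 1) (S : ℝ) :
    Integrable (cutSpherePower n r q S) := by
  rw [cutSpherePower, integrable_indicator_iff (isOpen_shell n r S).measurableSet]
  have h := integrableOn_Ioo_sub_rpow (r := r) (S := S) hq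
  exact integrableOn_shell_of_radial hn (IntegrableOn.continuousOn_mul_of_subset
    (K := Icc r S) (g := fun s => s ^ (n - 1)) (by fun_prop) h isCompact_Icc measurableSet_Ioo Ioo_subset_Icc_self)

lemma exists_setIntegral_le {X : Type*} [MeasurableSpace X] {μ : Measure X} {g : X → ℝ}
    (hg : Integrable g μ) (hg0 : ∀ x, 0 ≤ g x) {ε : ℝ} (hε : 0 < ε) :
    ∃ δ : ENNReal, 0 < δ ∧ ∀ s : Set X, μ s < δ → ∫ x in s, g x ∂μ ≤ ε := by
  obtain ⟨δ, hδ, h⟩ := exists_pos_setLIntegral_lt_of_measure_lt (μ := μ)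
    (f := fun x => ENNReal.ofReal (g x)) (by
      exact ((hasFiniteIntegral_iff_ofReal (Filter.Eventually.of_forall hg0)).1 hg.2).ne) (ε := ENNReal.ofReal ε) (by simpa using hε)
  refine ⟨δ, hδ, fun s hs => ?_⟩
  rw [integral_eq_lintegral_of_nonneg_ae (Filter.Eventually.of_forall hg0)
    hg.aestronglyMeasurable.restrict]
  exact ENNReal.toReal_le_of_le_ofReal hε.le (h s hs).le

/-- By Young's inequality the product of the two singularities is dominated by a sum of integrable
ones, whose integrals over sets of small measure are small uniformly in `x`. The exponents are
split as `-β = -γ (1 - t)` and `-θ = -q t` with `γ < n`, `q < 1`. -/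
lemma exists_singular_integral_le (hn : 0 < n) {r S β θ t ε : ℝ} (ht0 : 0 < t)
    (ht1 : t < 1) (hβ : β < n * (1 - t)) (hθ : θ < t) (hε : 0 < ε) :
    ∃ δ : ENNReal, 0 < δ ∧ ∀ B : Set (EuclideanSpace ℝ (Fin n)), MeasurableSet B →
      B ⊆ shell n r S → volume B < δ → ∀ x ∈ shell n r S,
      ∃ h : EuclideanSpace ℝ (Fin n) → ℝ, IntegrableOn h B ∧ ∫ y in B, h y ≤ ε ∧
        (∀ y, 0 ≤ h y) ∧
        ∀ y ∈ B, x ≠ y → ‖x - y‖ ^ (-β) * (‖y‖ - r) ^ (-θ) ≤ h y := by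
  have ht1' : 0 < 1 - t := by linarith
  have hγ : β / (1 - t) < n := by rwa [div_lt_iff₀ ht1']
  have hq : θ / t < 1 := by rwa [div_lt_one ht0]
  have hI1 := integrable_cutPower hn hγ (2 * S)
  have hI2 := integrable_cutSpherePower hn (r := r) hq S
  obtain ⟨δ₁, hδ₁, h₁⟩ := exists_setIntegral_le hI1 (cutPower_nonneg _ _) (half_pos hε)
  obtain ⟨δ₂, hδ₂, h₂⟩ := exists_setIntegral_le hI2 (cutSpherePower_nonneg _ _ _) (half_pos hε)
  refine ⟨min δ₁ δ₂, lt_min hδ₁ hδ₂, fun B hBm hB hvol x hx =>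
    ⟨fun y => cutPower n (β / (1 - t)) (2 * S) (x - y) + cutSpherePower n r (θ / t) S y,
      ?_, ?_, ?_, ?_⟩⟩
  · exact ((hI1.comp_sub_left x).add hI2).integrableOn
  · rw [integral_add (hI1.comp_sub_left x).integrableOn hI2.integrableOn]
    have hmp := Measure.measurePreserving_sub_left (volume : Measure (EuclideanSpace ℝ (Fin n))) x
    have hemb : MeasurableEmbedding fun y : EuclideanSpace ℝ (Fin n) => x - y :=
      (MeasurableEquiv.subLeft x).measurableEmbedding
    have hpre : (fun y => x - y) ⁻¹' ((fun y => x - y) ⁻¹' B) = B := by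
      ext y; simp
    have e := hmp.setIntegral_preimage_emb hemb (cutPower n (β / (1 - t)) (2 * S))
      ((fun y => x - y) ⁻¹' B)
    rw [hpre] at e
    rw [e]
    have hv : volume ((fun y => x - y) ⁻¹' B) = volume B :=
      hmp.measure_preimage hBm.nullMeasurableSet
    have := h₁ _ (hv.trans_lt (hvol.trans_le (min_le_left _ _)))
    have := h₂ _ (hvol.trans_le (min_le_right _ _))
    linarith
  · exact fun y => add_nonneg (cutPower_nonneg _ _ _) (cutSpherePower_nonneg _ _ _ _)
  · intro y hy hne
    have hD := norm_pos_iff.2 (sub_ne_zero.2 hne)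
    have hyS := hB hy
    have hyr : 0 < ‖y‖ - r := sub_pos.2 hyS.1
    have hmem : x - y ∈ shell n 0 (2 * S) :=
      ⟨hD, (norm_sub_le x y).trans_lt (by linarith [hx.2, hyS.2])⟩
    simp only [cutPower, cutSpherePower, indicator_of_mem hmem, indicator_of_mem hyS]
    have hy := Real.geom_mean_le_arith_mean2_weighted ht1'.le ht0.le
      (Real.rpow_nonneg hD.le (-(β / (1 - t)))) (Real.rpow_nonneg hyr.le (-(θ / t))) (by ring)
    rw [← Real.rpow_mul hD.le, ← Real.rpow_mul hyr.le, neg_mul, neg_mul,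
      div_mul_cancel₀ _ ht1'.ne', div_mul_cancel₀ _ ht0.ne'] at hy
    have := Real.rpow_nonneg hD.le (-(β / (1 - t)))
    have := Real.rpow_nonneg hyr.le (-(θ / t))
    nlinarith

lemma exists_volume_near_sphere_lt (hn : 0 < n) (ρ : ℝ) {δ : ENNReal} (hδ : 0 < δ) :
    ∃ η : ℝ, 0 < η ∧ volume {y : EuclideanSpace ℝ (Fin n) | |‖y‖ - ρ| < η} < δ := by
  have : Nontrivial (EuclideanSpace ℝ (Fin n)) :=
    Module.nontrivial_of_finrank_pos (R := ℝ) (by rwa [finrank_euclideanSpace_fin])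
  let s : ℕ → Set (EuclideanSpace ℝ (Fin n)) := fun k => {y | |‖y‖ - ρ| < 1 / ((k : ℝ) + 1)}
  have hopen : ∀ k, IsOpen (s k) := fun k => isOpen_lt (by fun_prop) continuous_const
  have hanti : Antitone s := fun j k hjk y hy =>
    (show |‖y‖ - ρ| < 1 / ((k : ℝ) + 1) from hy).trans_le
      (one_div_le_one_div_of_le (by positivity) (by gcongr))
  have hfin : volume (s 0) ≠ ⊤ := by
    refine ((measure_mono fun y hy => ?_).trans_lt
      (measure_ball_lt_top (x := (0 : EuclideanSpace ℝ (Fin n))) (r := ρ + 2))).ne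
    have : |‖y‖ - ρ| < 1 / (((0 : ℕ) : ℝ) + 1) := hy
    rw [mem_ball_zero_iff]
    norm_num at this
    linarith [(abs_lt.1 this).2]
  have hlim := tendsto_measure_iInter_atTop (μ := volume)
    (fun k => (hopen k).measurableSet.nullMeasurableSet) hanti ⟨0, hfin⟩
  have hzero : volume (⋂ k, s k) = 0 := by
    refine measure_mono_null (fun y hy => ?_)
      (Measure.addHaar_sphere volume (0 : EuclideanSpace ℝ (Fin n)) ρ)
    rw [mem_sphere_zero_iff_norm]
    by_contra hne
    obtain ⟨k, hk⟩ := exists_nat_one_div_lt (abs_pos.2 (sub_ne_zero.2 hne))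
    exact hk.not_gt (mem_iInter.1 hy k)
  rw [hzero] at hlim
  obtain ⟨k, hk⟩ := (hlim.eventually (gt_mem_nhds hδ)).exists
  exact ⟨1 / ((k : ℝ) + 1), by positivity, hk⟩

end Smallness

/-! ### The hypotheses on the nonlinearity in uniform form -/

section Nonlinearity

variable {n : ℕ} {α r : ℝ} {f : EuclideanSpace ℝ (Fin n) → ℝ → ℝ}

/-- All four alternatives of `Subcritical` amount to the same scaling inequality: with
`μ = t^{n-α}` if `α < n` and `μ = t²` if `α = n`, the two monotonicity ranges are exchanged by
changing the base point from `x` to `t² x`. -/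
lemma Subcritical.scaling (hsub : Subcritical n α r f) (hr : 0 < r) (hαn : α ≤ n)
    {x : EuclideanSpace ℝ (Fin n)} (hx : r < ‖x‖) {t v : ℝ} (ht : 1 < t) (hv : 0 < v) :
    f x v < t ^ ((n : ℝ) + α) * f (t ^ 2 • x) (t ^ (α - n) * v) := by
  have ht0 : 0 < t := one_pos.trans ht
  have ht2 : 1 < t ^ 2 := one_lt_pow₀ ht two_ne_zero
  have hx' : t ^ 2 • x ∈ exteriorDomain n r := by
    show r < ‖t ^ 2 • x‖
    rw [norm_smul, Real.norm_of_nonneg (by positivity)]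
    nlinarith
  rcases hαn.lt_or_eq with h | h
  · have hnα : 0 < (n : ℝ) - α := sub_pos.2 h
    set μ : ℝ := t ^ ((n : ℝ) - α) with hμ
    have hμ1 : 1 < μ := Real.one_lt_rpow ht hnα
    have hμ0 : 0 < μ := one_pos.trans hμ1
    have e1 : μ ^ (2 / ((n : ℝ) - α)) = t ^ 2 := by
      rw [hμ, ← Real.rpow_mul ht0.le, mul_div_cancel₀ _ hnα.ne']
      norm_cast
    have e2 : μ ^ (((n : ℝ) + α) / ((n : ℝ) - α)) = t ^ ((n : ℝ) + α) := by
      rw [hμ, ← Real.rpow_mul ht0.le, mul_div_cancel₀ _ hnα.ne']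
    have e3 : μ⁻¹ = t ^ (α - n) := by rw [hμ, ← Real.rpow_neg ht0.le, neg_sub]
    rcases hsub.1 h with H | H
    · have := H x hx v hv (mem_ofPred.2 le_rfl) (mem_ofPred.2 hμ1.le) hμ1
      simpa [e1, e2, e3] using this
    · have e4 : μ⁻¹ ^ (2 / ((n : ℝ) - α)) • t ^ 2 • x = x := by
        rw [Real.inv_rpow hμ0.le, e1, inv_smul_smul₀ (by positivity)]
      have := H (t ^ 2 • x) hx' (μ⁻¹ * v) (by positivity) (a := μ⁻¹) (b := 1)
        ⟨by positivity, inv_le_one_of_one_le₀ hμ1.le, by rw [e4]; exact hx⟩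
        ⟨one_pos, le_rfl, by simpa using hx'⟩ (inv_lt_one_of_one_lt₀ hμ1)
      simp only [Real.inv_rpow hμ0.le, e2, inv_inv, mul_inv_cancel_left₀ hμ0.ne', inv_one,
        one_mul, Real.one_rpow, one_smul] at this
      rwa [inv_mul_lt_iff₀ (by positivity), e3, e1, inv_smul_smul₀ (by positivity)] at this
  · have e1 : t ^ ((n : ℝ) + α) = (t ^ 2) ^ n := by
      rw [h, ← pow_mul, ← Real.rpow_natCast]
      push_cast; ring_nf
    have e2 : t ^ (α - n) = 1 := by rw [h, sub_self, Real.rpow_zero]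
    rw [e1, e2, one_mul]
    rcases hsub.2 h with H | H
    · have := H x hx v hv (mem_ofPred.2 le_rfl) (mem_ofPred.2 ht2.le) ht2
      simpa using this
    · have e4 : (t ^ 2)⁻¹ • t ^ 2 • x = x := inv_smul_smul₀ (by positivity) x
      have := H (t ^ 2 • x) hx' v hv (a := (t ^ 2)⁻¹) (b := 1)
        ⟨by positivity, inv_le_one_of_one_le₀ ht2.le, by rw [e4]; exact hx⟩
        ⟨one_pos, le_rfl, by simpa using hx'⟩ (inv_lt_one_of_one_lt₀ ht2)
      simp only [e4, one_pow, one_mul, one_smul, inv_pow] at this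
      rwa [inv_mul_lt_iff₀ (by positivity)] at this

/-- A function that is Lipschitz at scale `δ` on an interval is Lipschitz there. -/
lemma abs_sub_le_of_local {g : ℝ → ℝ} {M δ L : ℝ} (hδ : 0 < δ)
    (h : ∀ v ∈ Icc 0 M, ∀ w ∈ Icc 0 M, |v - w| < δ → |g v - g w| ≤ L * |v - w|) :
    ∀ v ∈ Icc 0 M, ∀ w ∈ Icc 0 M, |g v - g w| ≤ L * |v - w| := by
  have key : ∀ k : ℕ, ∀ v ∈ Icc 0 M, ∀ w ∈ Icc 0 M, v ≤ w → w - v ≤ k * (δ / 2) →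
      |g v - g w| ≤ L * (w - v) := by
    intro k
    induction k with
    | zero =>
      intro v _ w _ hvw hk
      have : v = w := by push_cast at hk; linarith
      simp [this]
    | succ k ih =>
      intro v hv w hw hvw hk
      push_cast at hk
      rcases le_total (w - v) (δ / 2) with h1 | h1
      · have := h v hv w hw (by rw [abs_sub_comm, abs_of_nonneg (by linarith)]; linarith)
        rwa [abs_sub_comm v w, abs_of_nonneg (by linarith : 0 ≤ w - v)] at this
      · have hm : w - δ / 2 ∈ Icc 0 M := ⟨by linarith [hv.1], by linarith [hw.2]⟩
        have h2 := ih v hv (w - δ / 2) hm (by linarith) (by linarith)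
        have h3 := h (w - δ / 2) hm w hw
          (by rw [abs_sub_comm, abs_of_nonneg (by linarith)]; linarith)
        rw [abs_sub_comm (w - δ / 2) w, abs_of_nonneg (by linarith : 0 ≤ w - (w - δ / 2))] at h3
        have := abs_sub_le (g v) (g (w - δ / 2)) (g w)
        linarith
  intro v hv w hw
  rcases le_total v w with hvw | hvw
  · obtain ⟨k, hk⟩ := exists_nat_ge ((w - v) / (δ / 2))
    rw [abs_sub_comm v w, abs_of_nonneg (sub_nonneg.2 hvw)]
    exact key k v hv w hw hvw ((div_le_iff₀ (half_pos hδ)).1 hk)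
  · obtain ⟨k, hk⟩ := exists_nat_ge ((v - w) / (δ / 2))
    rw [abs_sub_comm (g v), abs_of_nonneg (sub_nonneg.2 hvw)]
    exact key k w hw v hv hvw ((div_le_iff₀ (half_pos hδ)).1 hk)

/-- Compactness of `[0, M]` makes the Lipschitz constant uniform in the second variable. -/
lemma LocallyLipschitzOnU.exists_lipschitz {g : EuclideanSpace ℝ (Fin n) → ℝ → ℝ}
    (h : LocallyLipschitzOnU n r g) (S M : ℝ) :
    ∃ L : ℝ, 0 ≤ L ∧ ∀ x, r < ‖x‖ → ‖x‖ < S → ∀ v ∈ Icc 0 M, ∀ w ∈ Icc 0 M,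
      |g x v - g x w| ≤ L * |v - w| := by
  have hω : shell n r S ⊆ exteriorDomain n r := shell_subset_exteriorDomain le_rfl
  have hb : Bornology.IsBounded (shell n r S) :=
    (Metric.isBounded_ball (x := (0 : EuclideanSpace ℝ (Fin n))) (r := S)).subset fun y hy =>
      mem_ball_zero_iff.2 hy.2
  choose! V hVo hV L hL using fun u₀ (h0 : (0 : ℝ) ≤ u₀) => h u₀ h0 _ hω hb
  obtain ⟨T, hT⟩ := isCompact_Icc (a := (0 : ℝ)) (b := M).elim_finite_subcover
    (fun u₀ : Icc (0 : ℝ) M => V u₀) (fun u₀ => hVo _ u₀.2.1)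
    (fun u₀ hu => mem_iUnion.2 ⟨⟨u₀, hu⟩, hV _ hu.1⟩)
  obtain ⟨δ, hδ, hleb⟩ := lebesgue_number_lemma_of_metric (isCompact_Icc (a := (0 : ℝ)) (b := M))
    (c := fun u₀ : T => V u₀.1) (fun u₀ => hVo _ u₀.1.2.1) (by
      intro z hz
      obtain ⟨i, hi, hz⟩ := mem_iUnion₂.1 (hT hz)
      exact mem_iUnion.2 ⟨⟨i, hi⟩, hz⟩)
  refine ⟨∑ i ∈ T, |L i|, Finset.sum_nonneg fun _ _ => abs_nonneg _, fun x hx hxS => ?_⟩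
  refine abs_sub_le_of_local hδ fun v hv w hw hvw => ?_
  obtain ⟨i, hi⟩ := hleb v hv
  have h1 := hL i.1 i.1.2.1 x ⟨hx, hxS⟩ v ⟨hi (Metric.mem_ball_self hδ), hv.1⟩ w
    ⟨hi (by rwa [Metric.mem_ball, Real.dist_eq, abs_sub_comm]), hw.1⟩
  refine h1.trans (mul_le_mul_of_nonneg_right ?_ (abs_nonneg _))
  exact (le_abs_self _).trans
    (Finset.single_le_sum (f := fun i : Icc (0 : ℝ) M => |L i|) (fun _ _ => abs_nonneg _) i.2)

lemma LocallyLipschitzOnU.exists_lipschitz_of_weight {θ : ℝ}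
    (h : LocallyLipschitzOnU n r (fun x u => (‖x‖ - r) ^ θ * f x u)) (S M : ℝ) :
    ∃ L : ℝ, 0 ≤ L ∧ ∀ x, r < ‖x‖ → ‖x‖ < S → ∀ v ∈ Icc 0 M, ∀ w ∈ Icc 0 M,
      |f x v - f x w| ≤ L * (‖x‖ - r) ^ (-θ) * |v - w| := by
  obtain ⟨L, hL0, hL⟩ := h.exists_lipschitz S M
  refine ⟨L, hL0, fun x hx hxS v hv w hw => ?_⟩
  have hpos : 0 < (‖x‖ - r) ^ θ := Real.rpow_pos_of_pos (sub_pos.2 hx) _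
  have h1 := hL x hx hxS v hv w hw
  rw [← mul_sub, abs_mul, abs_of_pos hpos] at h1
  rw [Real.rpow_neg (sub_pos.2 hx).le, mul_right_comm, ← div_eq_mul_inv, le_div_iff₀ hpos]
  linarith

end Nonlinearity

lemma closure_exteriorDomain {n : ℕ} {r : ℝ} (hr : 0 < r) :
    closure (exteriorDomain n r) = {x | r ≤ ‖x‖} := by
  have : exteriorDomain n r = (Metric.closedBall 0 r)ᶜ := by
    ext x; simp [exteriorDomain]
  rw [this, closure_compl, interior_closedBall _ hr.ne']
  ext x; simp

/-- A positive solution of the integral equation, with the hypotheses on the nonlinearity in the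
uniform form used by the method of scaling spheres. -/
structure PositiveSolution (n : ℕ) (α r c θ : ℝ) (f : EuclideanSpace ℝ (Fin n) → ℝ → ℝ)
    (u : EuclideanSpace ℝ (Fin n) → ℝ) : Prop where
  n_pos : 0 < n
  α_pos : 0 < α
  α_le : α ≤ n
  r_pos : 0 < r
  c_pos : 0 < c
  θ_lt : θ < α / n
  nonneg : ∀ x, r < ‖x‖ → ∀ v, 0 ≤ v → 0 ≤ f x v
  scaling : ∀ x, r < ‖x‖ → ∀ t, 1 < t → ∀ v, 0 < v →
    f x v < t ^ ((n : ℝ) + α) * f (t ^ 2 • x) (t ^ (α - n) * v)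
  mono : ∀ x, r < ‖x‖ → ∀ v w, 0 ≤ v → v ≤ w → f x v ≤ f x w
  lip : ∀ S M : ℝ, ∃ L : ℝ, 0 ≤ L ∧ ∀ x, r < ‖x‖ → ‖x‖ < S → ∀ v ∈ Icc 0 M, ∀ w ∈ Icc 0 M,
    |f x v - f x w| ≤ L * (‖x‖ - r) ^ (-θ) * |v - w|
  cont : ContinuousOn u {x | r ≤ ‖x‖}
  pos : ∀ x, r < ‖x‖ → 0 < u x
  integrable : ∀ x, r < ‖x‖ →
    IntegrableOn (fun y => green n α r c x y * f y (u y)) (exteriorDomain n r)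
  eq : ∀ x, r < ‖x‖ → u x = ∫ y in exteriorDomain n r, green n α r c x y * f y (u y)

lemma pos_of_scaling {n : ℕ} {α r : ℝ} {f : EuclideanSpace ℝ (Fin n) → ℝ → ℝ} (hr : 0 < r)
    (hf : ∀ x, r < ‖x‖ → ∀ v, 0 ≤ v → 0 ≤ f x v)
    (hs : ∀ x, r < ‖x‖ → ∀ t, 1 < t → ∀ v, 0 < v →
      f x v < t ^ ((n : ℝ) + α) * f (t ^ 2 • x) (t ^ (α - n) * v))
    {x : EuclideanSpace ℝ (Fin n)} (hx : r < ‖x‖) {v : ℝ} (hv : 0 < v) : 0 < f x v := by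
  -- choose `t > 1` with `t⁻² x` still in the domain
  have h1 : 1 < ‖x‖ / r := (one_lt_div hr).2 hx
  obtain ⟨s, hs1, hs2⟩ := exists_between h1
  have hs0 : 0 < s := one_pos.trans hs1
  set t := Real.sqrt s with ht
  have ht1 : 1 < t := Real.lt_sqrt_of_sq_lt (by simpa using hs1)
  have ht0 : 0 < t := one_pos.trans ht1
  have ht2 : t ^ 2 = s := Real.sq_sqrt hs0.le
  have hx' : r < ‖(t ^ 2)⁻¹ • x‖ := by
    rw [norm_smul, norm_inv, ht2, Real.norm_of_nonneg hs0.le, inv_mul_eq_div, lt_div_iff₀ hs0]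
    rwa [lt_div_iff₀' hr] at hs2
  have hv' : 0 < (t ^ (α - n))⁻¹ * v := by positivity
  have h2 := hs _ hx' t ht1 _ hv'
  rw [smul_inv_smul₀ (by positivity), mul_inv_cancel_left₀ (by positivity)] at h2
  exact pos_of_mul_pos_right ((hf _ hx' _ hv'.le).trans_lt h2) (by positivity)

/-- The equation propagates positivity from one point to the whole domain. -/
lemma pos_of_solvesIE {n : ℕ} {α r c : ℝ} {f : EuclideanSpace ℝ (Fin n) → ℝ → ℝ}
    {u : EuclideanSpace ℝ (Fin n) → ℝ} (hn : 0 < n) (hα : 0 < α) (hr : 0 < r) (hc : 0 < c)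
    (hf : ∀ x, r < ‖x‖ → ∀ v, 0 ≤ v → 0 ≤ f x v)
    (hfp : ∀ x, r < ‖x‖ → ∀ v, 0 < v → 0 < f x v)
    (hu : ContinuousOn u (exteriorDomain n r)) (hu0 : ∀ x, r < ‖x‖ → 0 ≤ u x)
    {x₀ : EuclideanSpace ℝ (Fin n)} (hx₀ : r < ‖x₀‖) (h₀ : 0 < u x₀)
    {x : EuclideanSpace ℝ (Fin n)} (hx : r < ‖x‖)
    (hi : IntegrableOn (fun y => green n α r c x y * f y (u y)) (exteriorDomain n r)) :
    0 < ∫ y in exteriorDomain n r, green n α r c x y * f y (u y) := by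
  have : Nontrivial (EuclideanSpace ℝ (Fin n)) :=
    Module.nontrivial_of_finrank_pos (R := ℝ) (by rwa [finrank_euclideanSpace_fin])
  have hΩ := isOpen_exteriorDomain n r
  rw [setIntegral_pos_iff_support_of_nonneg_ae]
  · have hopen : IsOpen (exteriorDomain n r ∩ u ⁻¹' Ioi 0) := hu.isOpen_inter_preimage hΩ isOpen_Ioi
    have hpos : 0 < volume (exteriorDomain n r ∩ u ⁻¹' Ioi 0) :=
      hopen.measure_pos _ ⟨x₀, hx₀, h₀⟩
    rw [← measure_sdiff_null (measure_singleton x)] at hpos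
    refine hpos.trans_le (measure_mono fun y hy => ⟨?_, hy.1.1⟩)
    exact (mul_pos (green_pos hα hr hc hx hy.1.1 (Ne.symm hy.2)) (hfp y hy.1.1 _ hy.1.2)).ne'
  · filter_upwards [ae_restrict_mem hΩ.measurableSet] with y hy
    exact mul_nonneg (green_nonneg hα hr hc x y) (hf y hy _ (hu0 y hy))
  · exact hi

/-! ### Scaling spheres -/

section ScalingSpheres

variable {n : ℕ} {α r c θ R : ℝ} {f : EuclideanSpace ℝ (Fin n) → ℝ → ℝ}
  {u : EuclideanSpace ℝ (Fin n) → ℝ} {x y : EuclideanSpace ℝ (Fin n)}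

/-- The Kelvin transform `u_R(x) = (R/|x|)^{n-α} u(R² x/|x|²)`. -/
noncomputable def kelvin (α R : ℝ) (u : EuclideanSpace ℝ (Fin n) → ℝ)
    (x : EuclideanSpace ℝ (Fin n)) : ℝ :=
  (R / ‖x‖) ^ ((n : ℝ) - α) * u (reflect R x)

namespace PositiveSolution

lemma continuousAt (h : PositiveSolution n α r c θ f u) (hx : r < ‖x‖) : ContinuousAt u x := by
  refine h.cont.continuousAt (Filter.mem_of_superset
    ((isOpen_exteriorDomain n r).mem_nhds hx) fun y hy =>
      (show r < ‖y‖ from hy).le)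

lemma exists_le (h : PositiveSolution n α r c θ f u) (S : ℝ) :
    ∃ M : ℝ, 0 ≤ M ∧ ∀ x, r < ‖x‖ → ‖x‖ < S → u x ≤ M := by
  have hK : IsCompact (Metric.closedBall (0 : EuclideanSpace ℝ (Fin n)) S ∩ {x | r ≤ ‖x‖}) :=
    (isCompact_closedBall _ _).inter_right (isClosed_le continuous_const continuous_norm)
  obtain ⟨M, hM⟩ := hK.bddAbove_image (h.cont.mono inter_subset_right)
  exact ⟨max M 0, le_max_right _ _, fun x hx hxS => (hM ⟨x,
    ⟨mem_closedBall_zero_iff.2 hxS.le, hx.le⟩, rfl⟩).trans (le_max_left _ _)⟩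

lemma kelvin_pos (h : PositiveSolution n α r c θ f u) (hx : x ∈ shell n r R) :
    0 < kelvin α R u x := by
  have hx0 : 0 < ‖x‖ := h.r_pos.trans hx.1
  have hR : 0 < R := hx0.trans hx.2
  have := h.pos _ (hx.1.trans (hx.2.trans (lt_norm_reflect h.r_pos hx.1 hx.2)))
  unfold kelvin
  positivity

lemma continuousAt_kelvin (h : PositiveSolution n α r c θ f u) (hx : x ∈ shell n r R) :
    ContinuousAt (fun z : ℝ × EuclideanSpace ℝ (Fin n) => kelvin α z.1 u z.2) (R, x) := by
  have hx0 : 0 < ‖x‖ := h.r_pos.trans hx.1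
  have hR : 0 < R := hx0.trans hx.2
  have h1 : ContinuousAt (fun z : ℝ × EuclideanSpace ℝ (Fin n) => z.1 / ‖z.2‖) (R, x) :=
    continuousAt_fst.div continuousAt_snd.norm hx0.ne'
  have h2 : ContinuousAt (fun z : ℝ × EuclideanSpace ℝ (Fin n) => reflect z.1 z.2) (R, x) :=
    (h1.pow 2).smul continuousAt_snd
  refine (h1.rpow_const (Or.inl (by positivity))).mul
    (ContinuousAt.comp (f := fun z : ℝ × EuclideanSpace ℝ (Fin n) => reflect z.1 z.2) ?_ h2)
  exact h.continuousAt (hx.1.trans (hx.2.trans (lt_norm_reflect h.r_pos hx.1 hx.2)))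

lemma setIntegral_foldedGain_le (h : PositiveSolution n α r c θ f u) (hx : x ∈ shell n r R) :
    IntegrableOn (foldedGain n α r c R (fun y => f y (u y)) x) (shell n r R) ∧
      ∫ y in shell n r R, foldedGain n α r c R (fun y => f y (u y)) x y ≤ kelvin α R u x - u x := by
  have hx' := hx.1.trans (hx.2.trans (lt_norm_reflect h.r_pos hx.1 hx.2))
  rw [kelvin, h.eq x hx.1, h.eq _ hx']
  exact ExteriorLiouville.setIntegral_foldedGain_le h.α_pos h.r_pos h.c_pos
    (fun y hy => h.nonneg y hy _ (h.pos y hy).le) hx (h.integrable x hx.1) (h.integrable _ hx')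

/-- The scaling hypothesis compares the reflected source with `f(y, u_R(y))`, and the total gain of
the kernel is positive. -/
lemma lt_foldedGain (h : PositiveSolution n α r c θ f u) (hx : x ∈ shell n r R)
    (hy : y ∈ shell n r R) (hne : x ≠ y) :
    ((R / ‖y‖) ^ ((n : ℝ) - α) * ((R / ‖x‖) ^ ((n : ℝ) - α) *
        green n α r c (reflect R x) (reflect R y)) -
      (R / ‖y‖) ^ ((n : ℝ) - α) * green n α r c x (reflect R y)) *
        (f y (kelvin α R u y) - f y (u y)) <
      foldedGain n α r c R (fun y => f y (u y)) x y := by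
  have hr := h.r_pos
  have hy0 : 0 < ‖y‖ := hr.trans hy.1
  have hR : 0 < R := hy0.trans hy.2
  have ht : 1 < R / ‖y‖ := (one_lt_div hy0).2 hy.2
  have ht0 : 0 < R / ‖y‖ := one_pos.trans ht
  have h1 := h.scaling y hy.1 _ ht _ (h.kelvin_pos hy)
  have e1 : (R / ‖y‖) ^ (α - n) * kelvin α R u y = u (reflect R y) := by
    rw [kelvin, ← mul_assoc, ← Real.rpow_add ht0, sub_add_sub_cancel, sub_self, Real.rpow_zero,
      one_mul]
  have e2 : (R / ‖y‖) ^ (2 * n) = (R / ‖y‖) ^ ((n : ℝ) - α) * (R / ‖y‖) ^ ((n : ℝ) + α) := by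
    rw [← Real.rpow_add ht0, ← Real.rpow_natCast]
    congr 1
    push_cast; ring
  rw [e1] at h1
  have h2 := green_reflect_right_le h.α_pos hr h.c_pos hx.1 hx.2 hy.1 hy.2 hne
  have h3 := green_add_lt h.α_pos hr h.c_pos hx.1 hx.2 hy.1 hy.2 hne
  have h4 : 0 < f y (u y) := pos_of_scaling hr h.nonneg h.scaling hy.1 (h.pos y hy.1)
  have h5 := mul_le_mul_of_nonneg_left h1.le (sub_nonneg.2 h2)
  have h6 := mul_lt_mul_of_pos_right h3 h4
  rw [foldedGain, e2]
  simp only [reflect] at *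
  linarith

lemma foldedGain_pos (h : PositiveSolution n α r c θ f u) (hx : x ∈ shell n r R)
    (hy : y ∈ shell n r R) (hne : x ≠ y) (hu : u y ≤ kelvin α R u y) :
    0 < foldedGain n α r c R (fun y => f y (u y)) x y :=
  (mul_nonneg (sub_nonneg.2 (green_reflect_right_le h.α_pos h.r_pos h.c_pos hx.1 hx.2 hy.1 hy.2
    hne)) (sub_nonneg.2 (h.mono y hy.1 _ _ (h.pos y hy.1).le hu))).trans_lt
    (h.lt_foldedGain hx hy hne)

/-- Strong maximum principle: a non-strict comparison on the whole shell is strict. -/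
lemma lt_kelvin_of_le (h : PositiveSolution n α r c θ f u)
    (hle : ∀ y ∈ shell n r R, u y ≤ kelvin α R u y) (hx : x ∈ shell n r R) :
    u x < kelvin α R u x := by
  have : Nontrivial (EuclideanSpace ℝ (Fin n)) :=
    Module.nontrivial_of_finrank_pos (R := ℝ) (by rw [finrank_euclideanSpace_fin]; exact h.n_pos)
  obtain ⟨hi, hint⟩ := h.setIntegral_foldedGain_le hx
  have hm := (isOpen_shell n r R).measurableSet
  have hpos : ∀ᵐ y ∂(volume.restrict (shell n r R)),
      0 < foldedGain n α r c R (fun y => f y (u y)) x y := by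
    filter_upwards [ae_restrict_mem hm, ae_restrict_of_ae (Measure.ae_ne volume x)] with y hy hne
    exact h.foldedGain_pos hx hy (Ne.symm hne) (hle y hy)
  have hlt : 0 < ∫ y in shell n r R, foldedGain n α r c R (fun y => f y (u y)) x y := by
    rw [integral_pos_iff_support_of_nonneg_ae (hpos.mono fun _ => le_of_lt) hi]
    have hv : 0 < volume.restrict (shell n r R) univ := by
      rw [Measure.restrict_apply_univ]
      exact (isOpen_shell n r R).measure_pos _ ⟨x, hx⟩
    refine hv.trans_le (measure_mono_ae ?_)
    filter_upwards [hpos] with y hy _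
    exact hy.ne'
  linarith

/-- Where the comparison fails, the loss is controlled linearly by its defect. -/
lemma exists_neg_foldedGain_le (h : PositiveSolution n α r c θ f u) (S : ℝ) {ε : ℝ} (hε : 0 < ε)
    (hεα : ε ≤ α / 2) :
    ∃ k : ℝ, 0 ≤ k ∧ ∀ R ≤ S, ∀ x ∈ shell n r R, ∀ y ∈ shell n r R, x ≠ y →
      kelvin α R u y < u y →
      -foldedGain n α r c R (fun y => f y (u y)) x y ≤
        k * (‖x - y‖ ^ (-((n : ℝ) - α + 2 * ε)) * (‖y‖ - r) ^ (-θ)) *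
          (u y - kelvin α R u y) := by
  obtain ⟨M, -, hM⟩ := h.exists_le S
  obtain ⟨L, hL0, hL⟩ := h.lip S M
  obtain ⟨k, hk0, hk⟩ := exists_green_reflect_both_le h.α_pos h.α_le h.r_pos h.c_pos S hε hεα
  refine ⟨k * L, by positivity, fun R hRS x hx y hy hne hlt => ?_⟩
  have hyS : ‖y‖ < S := hy.2.trans_le hRS
  have hyR0 := (h.kelvin_pos hy).le
  have hyM := hM y hy.1 hyS
  have h1 := (le_abs_self _).trans (hL y hy.1 hyS (u y) ⟨(h.pos y hy.1).le, hyM⟩ (kelvin α R u y)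
    ⟨hyR0, hlt.le.trans hyM⟩)
  rw [abs_of_pos (sub_pos.2 hlt)] at h1
  have h2 := (h.lt_foldedGain hx hy hne).le
  have h3 := hk R hRS x y hx.1 hx.2 hy.1 hy.2 hne
  have h4 : 0 ≤ (R / ‖y‖) ^ ((n : ℝ) - α) * green n α r c x (reflect R y) := by
    have : 0 < R := h.r_pos.trans (hx.1.trans hx.2)
    have := green_nonneg h.α_pos h.r_pos h.c_pos x (reflect R y)
    positivity
  have h5 := green_reflect_right_le h.α_pos h.r_pos h.c_pos hx.1 hx.2 hy.1 hy.2 hne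
  set K4 := (R / ‖y‖) ^ ((n : ℝ) - α) * ((R / ‖x‖) ^ ((n : ℝ) - α) *
        green n α r c (reflect R x) (reflect R y))
  set K2 := (R / ‖y‖) ^ ((n : ℝ) - α) * green n α r c x (reflect R y)
  have hyr : 0 < ‖y‖ - r := sub_pos.2 hy.1
  have h6 : 0 ≤ L * (‖y‖ - r) ^ (-θ) * (u y - kelvin α R u y) :=
    mul_nonneg (by positivity) (sub_nonneg.2 hlt.le)
  calc _ ≤ (K4 - K2) * (f y (u y) - f y (kelvin α R u y)) := by linarith
    _ ≤ (K4 - K2) * (L * (‖y‖ - r) ^ (-θ) * (u y - kelvin α R u y)) :=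
        mul_le_mul_of_nonneg_left h1 (sub_nonneg.2 h5)
    _ ≤ (k * ‖x - y‖ ^ (-((n : ℝ) - α + 2 * ε))) *
          (L * (‖y‖ - r) ^ (-θ) * (u y - kelvin α R u y)) :=
        mul_le_mul_of_nonneg_right (by linarith) h6
    _ = _ := by ring

/-- Maximum principle in narrow regions: if the comparison is known outside a set of small measure,
then it holds everywhere, because the bound for its defect can be halved repeatedly. -/
lemma exists_narrow_principle (h : PositiveSolution n α r c θ f u) (S : ℝ) :
    ∃ δ : ENNReal, 0 < δ ∧ ∀ R ≤ S, ∀ B ⊆ shell n r R, MeasurableSet B → volume B < δ →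
      (∀ y ∈ shell n r R, y ∉ B → u y ≤ kelvin α R u y) →
      ∀ y ∈ shell n r R, u y ≤ kelvin α R u y := by
  have : Nontrivial (EuclideanSpace ℝ (Fin n)) :=
    Module.nontrivial_of_finrank_pos (R := ℝ) (by rw [finrank_euclideanSpace_fin]; exact h.n_pos)
  have hn0 : (0 : ℝ) < n := by exact_mod_cast h.n_pos
  -- the weight `t` of Young's inequality lies strictly between `θ` and `α / n`
  obtain ⟨t, ht1, ht2⟩ := exists_between (max_lt h.θ_lt (div_pos h.α_pos hn0))
  have htθ : θ < t := (le_max_left _ _).trans_lt ht1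
  have ht0 : 0 < t := (le_max_right _ _).trans_lt ht1
  have htn : t * n < α := (lt_div_iff₀ hn0).1 ht2
  have ht1' : t < 1 := ht2.trans_le ((div_le_one hn0).2 h.α_le)
  set ε := (α - t * n) / 4 with hε
  have hε0 : 0 < ε := by rw [hε]; linarith
  have htn0 : 0 < t * n := by positivity
  obtain ⟨k, hk0, hk⟩ := h.exists_neg_foldedGain_le S hε0 (by rw [hε]; linarith)
  obtain ⟨M, hM0, hM⟩ := h.exists_le S
  have hβ : (n : ℝ) - α + 2 * ε < n * (1 - t) := by rw [hε]; linarith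
  obtain ⟨δ, hδ, hsmall⟩ := exists_singular_integral_le (n := n) (r := r) (S := S) h.n_pos ht0 ht1'
    hβ htθ (ε := 1 / (2 * (k + 1))) (by positivity)
  refine ⟨δ, hδ, fun R hRS B hB hBm hvol hout => ?_⟩
  have hsub : shell n r R ⊆ shell n r S := fun y hy => ⟨hy.1, hy.2.trans_le hRS⟩
  have hm := (isOpen_shell n r R).measurableSet
  have step : ∀ D : ℝ, 0 ≤ D → (∀ y ∈ shell n r R, u y - kelvin α R u y ≤ D) →
      ∀ y ∈ shell n r R, u y - kelvin α R u y ≤ D / 2 := by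
    intro D hD0 hD x hx
    obtain ⟨hi, hint⟩ := h.setIntegral_foldedGain_le hx
    obtain ⟨H, hHi, hHint, hH0, hH⟩ := hsmall B hBm (hB.trans hsub) hvol x (hsub hx)
    have hle : ∫ y in shell n r R, -foldedGain n α r c R (fun y => f y (u y)) x y ≤
        ∫ y in shell n r R, B.indicator (fun y => k * D * H y) y := by
      refine integral_mono_ae hi.neg ?_ ?_
      · exact (IntegrableOn.integrable_indicator (hHi.const_mul _) hBm).integrableOn
      filter_upwards [ae_restrict_mem hm, ae_restrict_of_ae (Measure.ae_ne volume x)] with y hy hne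
      rcases lt_or_ge (kelvin α R u y) (u y) with hlt | hge
      · have hyB : y ∈ B := by
          by_contra hyB
          exact hlt.not_ge (hout y hy hyB)
        rw [indicator_of_mem hyB]
        calc _ ≤ k * (‖x - y‖ ^ (-((n : ℝ) - α + 2 * ε)) * (‖y‖ - r) ^ (-θ)) *
              (u y - kelvin α R u y) := hk R hRS x hx y hy (Ne.symm hne) hlt
          _ ≤ k * H y * D := by
              have hH' := hH y hyB (Ne.symm hne)
              have hH0' := hH0 y
              have hD' := hD y hy
              have := sub_pos.2 hlt
              gcongr
          _ = _ := by ring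
      · have h1 := h.foldedGain_pos hx hy (Ne.symm hne) hge
        have h2 : 0 ≤ B.indicator (fun y => k * D * H y) y :=
          indicator_nonneg (fun z _ => mul_nonneg (by positivity) (hH0 z)) y
        show -foldedGain n α r c R (fun y => f y (u y)) x y ≤ _
        linarith
    rw [integral_neg, setIntegral_indicator hBm, inter_eq_right.2 hB, integral_const_mul] at hle
    have h3 : k * D * ∫ y in B, H y ≤ k * D * (1 / (2 * (k + 1))) :=
      mul_le_mul_of_nonneg_left hHint (by positivity)
    have h4 : k * D * (1 / (2 * (k + 1))) ≤ D / 2 := by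
      rw [mul_one_div, div_le_div_iff₀ (by positivity) two_pos]
      nlinarith
    linarith
  have hall : ∀ j : ℕ, ∀ y ∈ shell n r R, u y - kelvin α R u y ≤ M / 2 ^ j := by
    intro j
    induction j with
    | zero =>
      intro y hy
      have := hM y hy.1 (hsub hy).2
      have := h.kelvin_pos hy
      simp only [pow_zero, div_one]
      linarith
    | succ j ih =>
      intro y hy
      rw [pow_succ, ← div_div]
      exact step _ (by positivity) ih y hy
  intro y hy
  have hlim : Filter.Tendsto (fun j : ℕ => M / 2 ^ j) Filter.atTop (nhds 0) :=
    tendsto_const_nhds.div_atTop (tendsto_pow_atTop_atTop_of_one_lt one_lt_two)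
  exact sub_nonpos.1 (ge_of_tendsto' hlim fun j => hall j y hy)

/-- The comparison `u ≤ u_R` inside the sphere `|x| = R` holds for every radius: the set of good
radii is closed, and by the strong and the narrow maximum principles it is open to the right. It
starts at `R = r`, where the shell is empty. -/
theorem le_kelvin (h : PositiveSolution n α r c θ f u) (hx : x ∈ shell n r R) :
    u x ≤ kelvin α R u x := by
  set good : Set ℝ := {R | ∀ x ∈ shell n r R, u x ≤ kelvin α R u x} with hgood
  suffices hsub : ∀ b, Icc r b ⊆ good from
    hsub R ⟨(hx.1.trans hx.2).le, le_rfl⟩ x hx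
  intro b
  refine IsClosed.Icc_subset_of_forall_exists_gt ?_ ?_ ?_
  · refine IsSeqClosed.isClosed fun ρ ρ₀ hρ hlim => ⟨fun x hx => ?_, ?_⟩
    · have hev : ∀ᶠ j in Filter.atTop, ‖x‖ < ρ j := hlim.eventually (lt_mem_nhds hx.2)
      have hcont : ContinuousAt (fun R : ℝ => kelvin α R u x) ρ₀ :=
        (h.continuousAt_kelvin hx).comp (f := fun R : ℝ => (R, x)) (by fun_prop)
      refine ge_of_tendsto (hcont.tendsto.comp hlim) ?_
      filter_upwards [hev] with j hj
      exact (hρ j).1 x ⟨hx.1, hj⟩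
    · exact isClosed_Icc.mem_of_tendsto hlim (Filter.Eventually.of_forall fun j => (hρ j).2)
  · exact fun x hx => absurd (hx.1.trans hx.2) (lt_irrefl r)
  · rintro ρ ⟨hρ, hρr, hρb⟩ y (hy : ρ < y)
    obtain ⟨δ, hδ, hnarrow⟩ := h.exists_narrow_principle b
    have hδ2 : 0 < δ / 2 := ENNReal.half_pos hδ.ne'
    obtain ⟨η₁, hη₁, hv₁⟩ := exists_volume_near_sphere_lt h.n_pos r hδ2
    obtain ⟨η₂, hη₂, hv₂⟩ := exists_volume_near_sphere_lt h.n_pos ρ hδ2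
    -- away from both bounding spheres the strict comparison survives a small change of radius
    set K : Set (EuclideanSpace ℝ (Fin n)) :=
      Metric.closedBall 0 (ρ - η₂ / 2) ∩ {x | r + η₁ / 2 ≤ ‖x‖} with hK
    have hKc : IsCompact K :=
      (isCompact_closedBall _ _).inter_right (isClosed_le continuous_const continuous_norm)
    have hKs : K ⊆ shell n r ρ := fun x hx =>
      ⟨by have : r + η₁ / 2 ≤ ‖x‖ := hx.2
          linarith, by linarith [mem_closedBall_zero_iff.1 hx.1]⟩
    have hev : ∀ᶠ R in nhds ρ, ∀ x ∈ K, u x < kelvin α R u x := by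
      refine hKc.eventually_forall_of_forall_eventually fun x hx => ?_
      have hlt := h.lt_kelvin_of_le hρ (hKs hx)
      have hu : ContinuousAt (fun z : ℝ × EuclideanSpace ℝ (Fin n) => u z.2) (ρ, x) :=
        ContinuousAt.comp (f := fun z : ℝ × EuclideanSpace ℝ (Fin n) => z.2)
          (h.continuousAt (hKs hx).1) continuousAt_snd
      exact hu.eventually_lt (h.continuousAt_kelvin (hKs hx)) hlt
    obtain ⟨ε, hε, hball⟩ := Metric.eventually_nhds_iff.1 hev
    set e := min (min (ε / 2) (η₂ / 2)) (min (y - ρ) (b - ρ)) with he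
    have he0 : 0 < e := lt_min (lt_min (by linarith) (by linarith))
      (lt_min (by linarith) (by linarith))
    have he1 : e ≤ ε / 2 := (min_le_left _ _).trans (min_le_left _ _)
    have he2 : e ≤ η₂ / 2 := (min_le_left _ _).trans (min_le_right _ _)
    have he3 : e ≤ y - ρ := (min_le_right _ _).trans (min_le_left _ _)
    have he4 : e ≤ b - ρ := (min_le_right _ _).trans (min_le_right _ _)
    refine ⟨ρ + e, ?_, by linarith, by linarith⟩
    refine hnarrow (ρ + e) (by linarith) (shell n r (ρ + e) \ K) sdiff_subset
      ((isOpen_shell _ _ _).measurableSet.diff hKc.isClosed.measurableSet) ?_ ?_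
    · refine (measure_mono (t := {y | |‖y‖ - r| < η₁} ∪ {y | |‖y‖ - ρ| < η₂}) fun z hz => ?_).trans_lt
        ((measure_union_le _ _).trans_lt ((ENNReal.add_lt_add hv₁ hv₂).trans_eq
          (ENNReal.add_halves δ)))
      obtain ⟨⟨hz1, hz2⟩, hzK⟩ := hz
      by_cases hz3 : r + η₁ / 2 ≤ ‖z‖
      · have : ρ - η₂ / 2 < ‖z‖ := by
          by_contra hcon
          exact hzK ⟨mem_closedBall_zero_iff.2 (not_lt.1 hcon), hz3⟩
        refine Or.inr (show |‖z‖ - ρ| < η₂ from abs_lt.2 ⟨?_, ?_⟩) <;> linarith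
      · refine Or.inl (show |‖z‖ - r| < η₁ from abs_lt.2 ⟨?_, ?_⟩) <;> linarith
    · intro z hz hzK
      refine (hball (y := ρ + e) ?_ z ?_).le
      · rw [Real.dist_eq, add_sub_cancel_left, abs_of_pos he0]
        linarith
      · by_contra hcon
        exact hzK ⟨hz, hcon⟩

end PositiveSolution

end ScalingSpheres

/-! ### Lower bounds at infinity and the contradiction -/

section LowerBounds

variable {n : ℕ} {α r c θ R : ℝ} {f : EuclideanSpace ℝ (Fin n) → ℝ → ℝ}
  {u : EuclideanSpace ℝ (Fin n) → ℝ}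

namespace PositiveSolution

/-- The sphere of radius `√(R|z|)` exchanges `z` with the point of norm `R` on the same ray. -/
lemma le_rpow_mul (h : PositiveSolution n α r c θ f u) (hR : r < R)
    {z : EuclideanSpace ℝ (Fin n)} (hz : R < ‖z‖) :
    u ((R / ‖z‖) • z) ≤ (‖z‖ / R) ^ (((n : ℝ) - α) / 2) * u z := by
  have hR0 : 0 < R := h.r_pos.trans hR
  have hz0 : 0 < ‖z‖ := hR0.trans hz
  set ρ := Real.sqrt (R * ‖z‖) with hρ
  have hρ2 : ρ ^ 2 = R * ‖z‖ := Real.sq_sqrt (by positivity)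
  have hρ0 : 0 < ρ := Real.sqrt_pos.2 (by positivity)
  have e1 : (R / ‖z‖) • z = reflect ρ z := by
    rw [reflect, div_pow, hρ2]
    congr 1
    field_simp
  have hnorm : ‖reflect ρ z‖ = R := by
    rw [norm_reflect, hρ2]
    field_simp
  have hmem : reflect ρ z ∈ shell n r ρ := by
    refine ⟨by rwa [hnorm], ?_⟩
    rw [hnorm]
    exact Real.lt_sqrt_of_sq_lt (by nlinarith)
  have hle := h.le_kelvin hmem
  rw [kelvin, reflect_reflect hρ0.ne', hnorm] at hle
  have e2 : ‖z‖ / R = (ρ / R) ^ 2 := by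
    rw [div_pow, hρ2]
    field_simp
  rwa [e1, e2, sq_rpow_half (by positivity)]

lemma exists_rpow_le (h : PositiveSolution n α r c θ f u) (hR : r < R) :
    ∃ k : ℝ, 0 < k ∧ ∀ z, R < ‖z‖ → k * ‖z‖ ^ (-(((n : ℝ) - α) / 2)) ≤ u z := by
  have hR0 : 0 < R := h.r_pos.trans hR
  have hsub : Metric.sphere (0 : EuclideanSpace ℝ (Fin n)) R ⊆ {x | r ≤ ‖x‖} := fun x hx => by
    rw [mem_sphere_zero_iff_norm] at hx
    exact hR.le.trans_eq hx.symm
  obtain ⟨m, hm0, hm⟩ : ∃ m : ℝ, 0 < m ∧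
      ∀ x ∈ Metric.sphere (0 : EuclideanSpace ℝ (Fin n)) R, m ≤ u x :=
    (isCompact_sphere _ _).exists_forall_le' (h.cont.mono hsub) fun x hx =>
      h.pos x (by rwa [mem_sphere_zero_iff_norm.1 hx])
  refine ⟨m * R ^ (((n : ℝ) - α) / 2), by positivity, fun z hz => ?_⟩
  have hz0 : 0 < ‖z‖ := hR0.trans hz
  have h1 := hm ((R / ‖z‖) • z) (by
    rw [mem_sphere_zero_iff_norm, norm_smul, Real.norm_of_nonneg (by positivity),
      div_mul_cancel₀ _ hz0.ne'])
  have h2 := h1.trans (h.le_rpow_mul hR hz)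
  rw [Real.div_rpow hz0.le hR0.le, div_mul_eq_mul_div, le_div_iff₀ (by positivity)] at h2
  rw [Real.rpow_neg hz0.le, ← div_eq_mul_inv, div_le_iff₀ (by positivity)]
  linarith

end PositiveSolution

/-- A cone contains the dilates of a ball around a unit vector. -/
lemma IsConeAtZero.exists_ball (hn : 0 < n) {K : Set (EuclideanSpace ℝ (Fin n))}
    (hK : IsConeAtZero n K) :
    ∃ (z : EuclideanSpace ℝ (Fin n)) (ε : ℝ), ‖z‖ = 1 ∧ 0 < ε ∧ ε ≤ 1 / 2 ∧
      ∀ t : ℝ, 0 < t → Metric.ball (t • z) (t * ε) ⊆ K := by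
  have : Nontrivial (EuclideanSpace ℝ (Fin n)) :=
    Module.nontrivial_of_finrank_pos (R := ℝ) (by rwa [finrank_euclideanSpace_fin])
  have : (nhdsWithin (0 : EuclideanSpace ℝ (Fin n)) {0}ᶜ).NeBot :=
    Module.punctured_nhds_neBot ℝ _ 0
  obtain ⟨w, hw, hw0⟩ := (dense_compl_singleton (0 : EuclideanSpace ℝ (Fin n))).inter_open_nonempty
    _ isOpen_interior hK.2
  have hw0' : 0 < ‖w‖ := norm_pos_iff.2 hw0
  obtain ⟨ε, hε, hball⟩ := Metric.isOpen_iff.1 isOpen_interior w hw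
  refine ⟨‖w‖⁻¹ • w, min (ε / ‖w‖) (1 / 2), ?_, by positivity, min_le_right _ _,
    fun t ht y hy => ?_⟩
  · rw [norm_smul, norm_inv, norm_norm, inv_mul_cancel₀ hw0'.ne']
  · -- dilate `y` back into the ball around `w`
    have hs : 0 < t / ‖w‖ := by positivity
    have hmem : (t / ‖w‖)⁻¹ • y ∈ K := by
      refine interior_subset (hball ?_)
      have hy' : ‖y - (t / ‖w‖) • w‖ < t * (ε / ‖w‖) := by
        rw [mem_ball_iff_norm, smul_smul, ← div_eq_mul_inv] at hy
        exact hy.trans_le (by gcongr; exact min_le_left _ _)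
      have e : (t / ‖w‖)⁻¹ • y - w = (t / ‖w‖)⁻¹ • (y - (t / ‖w‖) • w) := by
        rw [smul_sub, inv_smul_smul₀ hs.ne']
      rw [mem_ball_iff_norm, e, norm_smul, norm_inv, Real.norm_of_nonneg hs.le, inv_mul_lt_iff₀ hs]
      exact hy'.trans_eq (by ring)
    have h := hK.1 _ hmem _ hs
    rwa [smul_inv_smul₀ hs.ne'] at h

lemma norm_mem_of_mem_ball {z y : EuclideanSpace ℝ (Fin n)} {ε t : ℝ} (hz : ‖z‖ = 1)
    (hε : ε ≤ 1 / 2) (ht : 0 < t) (hy : y ∈ Metric.ball (t • z) (t * ε)) :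
    t / 2 < ‖y‖ ∧ ‖y‖ < 3 / 2 * t := by
  have h1 : ‖t • z‖ = t := by rw [norm_smul, hz, mul_one, Real.norm_of_nonneg ht.le]
  have h2 : ‖y - t • z‖ < t / 2 := (mem_ball_iff_norm.1 hy).trans_le (by nlinarith)
  have h3 := abs_lt.1 ((abs_norm_sub_norm_le y (t • z)).trans_lt h2)
  rw [h1] at h3
  constructor <;> linarith [h3.1, h3.2]

lemma exists_rpow_le_rpow_of_comparable (e : ℝ) :
    ∃ m : ℝ, 0 < m ∧ ∀ s t : ℝ, 0 < t → t / 2 < s → s < 3 / 2 * t → m * t ^ e ≤ s ^ e := by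
  refine ⟨min ((1 / 2) ^ e) ((3 / 2) ^ e), by positivity, fun s t ht h1 h2 => ?_⟩
  have hs : 0 < s := by linarith
  rcases le_total 0 e with he | he
  · calc _ ≤ (1 / 2) ^ e * t ^ e := by gcongr; exact min_le_left _ _
      _ = (1 / 2 * t) ^ e := by rw [Real.mul_rpow (by norm_num) ht.le]
      _ ≤ s ^ e := Real.rpow_le_rpow (by positivity) (by linarith) he
  · calc _ ≤ (3 / 2) ^ e * t ^ e := by gcongr; exact min_le_right _ _
      _ = (3 / 2 * t) ^ e := by rw [Real.mul_rpow (by norm_num) ht.le]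
      _ ≤ s ^ e := Real.rpow_le_rpow_of_nonpos hs h2.le he

/-- A power lower bound for `u` bounds from below the contribution to the integral equation of the
dilated ball `B(tz, tε)` in the cone. -/
lemma PositiveSolution.exists_le_setIntegral_ball (h : PositiveSolution n α r c θ f u)
    {K : Set (EuclideanSpace ℝ (Fin n))} {z : EuclideanSpace ℝ (Fin n)} {C σ τ p ε κ k : ℝ}
    (hC : 0 < C) (hp : 0 < p) (hRr : 2 * r ≤ R) (hRσ : 2 * σ * r ≤ R)
    (hz : ‖z‖ = 1) (hε : 0 < ε) (hε2 : ε ≤ 1 / 2)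
    (hball : ∀ t : ℝ, 0 < t → Metric.ball (t • z) (t * ε) ⊆ K)
    (hf : ∀ x ∈ K ∩ exteriorDomain n (2 * σ * r), ∀ v : ℝ, 0 ≤ v → C * ‖x‖ ^ τ * v ^ p ≤ f x v)
    (hk : 0 < k) (hu : ∀ y, R ≤ ‖y‖ → k * ‖y‖ ^ (-κ) ≤ u y) :
    ∃ k' : ℝ, 0 < k' ∧ ∀ x, R ≤ ‖x‖ → ∀ t, 4 * ‖x‖ ≤ t →
      k' * t ^ (α + τ - p * κ) ≤
        ∫ y in Metric.ball (t • z) (t * ε), green n α r c x y * f y (u y) := by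
  have hr := h.r_pos
  have hR0 : 0 < R := by linarith
  have : Nontrivial (EuclideanSpace ℝ (Fin n)) :=
    Module.nontrivial_of_finrank_pos (R := ℝ) (by rw [finrank_euclideanSpace_fin]; exact h.n_pos)
  obtain ⟨g, hg0, hg⟩ := exists_le_green (n := n) h.α_pos hr h.c_pos
  obtain ⟨m, hm0, hm⟩ := exists_rpow_le_rpow_of_comparable (α - n + τ - p * κ)
  set V := volume.real (Metric.ball (0 : EuclideanSpace ℝ (Fin n)) ε) with hV
  have hV0 : 0 < V := ENNReal.toReal_pos (Metric.measure_ball_pos _ _ hε).ne' measure_ball_lt_top.ne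
  refine ⟨g * C * k ^ p * m * V, by positivity, fun x hx t ht => ?_⟩
  have hx0 : 0 < ‖x‖ := hR0.trans_le hx
  have ht0 : 0 < t := by linarith
  have hsub : Metric.ball (t • z) (t * ε) ⊆ exteriorDomain n r := fun y hy => by
    have := (norm_mem_of_mem_ball hz hε2 ht0 hy).1
    show r < ‖y‖
    linarith
  have hlow : ∀ y ∈ Metric.ball (t • z) (t * ε),
      g * C * k ^ p * m * t ^ (α - n + τ - p * κ) ≤ green n α r c x y * f y (u y) := by
    intro y hy
    obtain ⟨hy1, hy2⟩ := norm_mem_of_mem_ball hz hε2 ht0 hy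
    have hy0 : 0 < ‖y‖ := by linarith
    have hyR : R ≤ ‖y‖ := by linarith
    have h1 := hg x y (by linarith) (by linarith)
    have h2 := hf y ⟨hball t ht0 hy, show 2 * σ * r < ‖y‖ by linarith⟩ _
      (h.pos y (by linarith)).le
    have h3 : (k * ‖y‖ ^ (-κ)) ^ p ≤ u y ^ p :=
      Real.rpow_le_rpow (by positivity) (hu y hyR) hp.le
    have e : ‖y‖ ^ (α - n + τ - p * κ) = ‖y‖ ^ (α - n) * (‖y‖ ^ τ * (‖y‖ ^ (-κ)) ^ p) := by
      rw [← Real.rpow_mul hy0.le, ← Real.rpow_add hy0, ← Real.rpow_add hy0]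
      ring_nf
    calc g * C * k ^ p * m * t ^ (α - n + τ - p * κ)
        = g * C * k ^ p * (m * t ^ (α - n + τ - p * κ)) := by ring
      _ ≤ g * C * k ^ p * ‖y‖ ^ (α - n + τ - p * κ) := by
          gcongr
          exact hm _ _ ht0 hy1 hy2
      _ = (g * ‖y‖ ^ (α - n)) * (C * ‖y‖ ^ τ * (k * ‖y‖ ^ (-κ)) ^ p) := by
          rw [e, Real.mul_rpow hk.le (by positivity)]
          ring
      _ ≤ (g * ‖y‖ ^ (α - n)) * (C * ‖y‖ ^ τ * u y ^ p) := by gcongr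
      _ ≤ _ := mul_le_mul h1 h2 (by have := h.pos y (by linarith); positivity)
          (green_nonneg h.α_pos hr h.c_pos _ _)
  have hint := setIntegral_mono_on (integrableOn_const measure_ball_lt_top.ne)
    ((h.integrable x (by linarith)).mono_set hsub) measurableSet_ball hlow
  rw [setIntegral_const, smul_eq_mul, measureReal_def,
    Measure.addHaar_ball_mul _ _ ht0.le, finrank_euclideanSpace_fin, ENNReal.toReal_mul,
    ENNReal.toReal_ofReal (by positivity), ← measureReal_def, ← hV] at hint
  refine le_trans (le_of_eq ?_) hint
  have e : t ^ (α + τ - p * κ) = t ^ n * t ^ (α - n + τ - p * κ) := by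
    rw [← Real.rpow_natCast, ← Real.rpow_add ht0]
    ring_nf
  rw [e]
  ring

lemma PositiveSolution.setIntegral_le (h : PositiveSolution n α r c θ f u)
    {x : EuclideanSpace ℝ (Fin n)} (hx : r < ‖x‖) {s t : Set (EuclideanSpace ℝ (Fin n))}
    (ht : MeasurableSet t) (hst : s ⊆ t) (hsub : t ⊆ exteriorDomain n r) :
    ∫ y in s, green n α r c x y * f y (u y) ≤ ∫ y in t, green n α r c x y * f y (u y) := by
  refine setIntegral_mono_set ((h.integrable x hx).mono_set hsub) ?_ hst.eventuallyLE
  filter_upwards [ae_restrict_mem ht] with y hy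
  exact mul_nonneg (green_nonneg h.α_pos h.r_pos h.c_pos _ _)
    (h.nonneg y (hsub hy) _ (h.pos y (hsub hy)).le)

/-- The lower bound `t^{α+τ-pκ}` for the contribution of the balls `B(tz, tε)` must tend to zero,
since the integral in the equation converges. -/
lemma PositiveSolution.exponent_neg (h : PositiveSolution n α r c θ f u)
    {z : EuclideanSpace ℝ (Fin n)} {e ε k : ℝ} (hR : r < R) (hz : ‖z‖ = 1) (hε2 : ε ≤ 1 / 2)
    (hk : 0 < k)
    (hball : ∀ x, R ≤ ‖x‖ → ∀ t, 4 * ‖x‖ ≤ t →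
      k * t ^ e ≤ ∫ y in Metric.ball (t • z) (t * ε), green n α r c x y * f y (u y)) :
    e < 0 := by
  by_contra! he
  have hr := h.r_pos
  have hR0 : 0 < R := hr.trans hR
  set x := R • z with hx
  have hxR : ‖x‖ = R := by rw [hx, norm_smul, hz, mul_one, Real.norm_of_nonneg hR0.le]
  have hsub : ∀ j : ℕ, exteriorDomain n (r + j) ⊆ exteriorDomain n r := fun j y hy =>
    show r < ‖y‖ from (le_add_of_nonneg_right j.cast_nonneg).trans_lt hy
  have hanti : Antitone fun j : ℕ => exteriorDomain n (r + j) := fun i j hij y hy =>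
    show r + i < ‖y‖ from (by gcongr : r + (i : ℝ) ≤ r + j).trans_lt hy
  have hempty : ⋂ j : ℕ, exteriorDomain n (r + j) = ∅ := by
    refine eq_empty_of_forall_notMem fun y hy => ?_
    obtain ⟨j, hj⟩ := exists_nat_ge ‖y‖
    have : r + j < ‖y‖ := mem_iInter.1 hy j
    linarith
  have hlim := tendsto_setIntegral_of_antitone (μ := volume)
    (f := fun y => green n α r c x y * f y (u y))
    (fun j : ℕ => (isOpen_exteriorDomain n (r + j)).measurableSet) hanti
    ⟨0, (h.integrable x (by rwa [hxR])).mono_set (hsub 0)⟩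
  rw [hempty, setIntegral_empty] at hlim
  refine hk.not_ge (ge_of_tendsto' hlim fun j => ?_)
  set t := 4 * R + 2 * (r + j) + 1 with ht
  have hj : (0 : ℝ) ≤ j := j.cast_nonneg
  have ht1 : 1 ≤ t := by rw [ht]; linarith
  have h1 := hball x hxR.ge t (by rw [hxR, ht]; linarith)
  have h2 : k ≤ k * t ^ e := le_mul_of_one_le_right hk.le (Real.one_le_rpow ht1 he)
  refine (h2.trans h1).trans (h.setIntegral_le (by rwa [hxR])
    (isOpen_exteriorDomain n (r + j)).measurableSet (fun y hy => ?_) (hsub j))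
  have := (norm_mem_of_mem_ball hz hε2 (by linarith) hy).1
  show r + j < ‖y‖
  linarith

/-- The exponents obtained by iterating `κ ↦ pκ - a` decrease by a fixed amount as long as they
are non-negative, so the iteration must stop. -/
lemma not_forall_iterate {P : ℝ → Prop} {κ₀ a p : ℝ} (hκ₀ : 0 ≤ κ₀) (ha : 0 < a)
    (hpa : (p - 1) * κ₀ < a) (h₀ : P κ₀)
    (h : ∀ κ, 0 ≤ κ → P κ → 0 < p * κ - a ∧ P (p * κ - a)) : False := by
  set δ := min a (a - (p - 1) * κ₀) with hδ
  have hδ0 : 0 < δ := lt_min ha (by linarith)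
  have hδ1 : δ ≤ a := min_le_left _ _
  have hδ2 : δ ≤ a - (p - 1) * κ₀ := min_le_right _ _
  have key : ∀ j : ℕ, ∃ κ, 0 ≤ κ ∧ κ ≤ κ₀ - j * δ ∧ P κ := by
    intro j
    induction j with
    | zero => exact ⟨κ₀, hκ₀, by simp, h₀⟩
    | succ j ih =>
      obtain ⟨κ, hκ, hκj, hP⟩ := ih
      obtain ⟨h1, h2⟩ := h κ hκ hP
      refine ⟨_, h1.le, ?_, h2⟩
      have hκκ₀ : κ ≤ κ₀ := by
        have : 0 ≤ (j : ℝ) * δ := by positivity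
        linarith
      have : (p - 1) * κ ≤ a - δ := by
        rcases le_total p 1 with hp | hp <;> nlinarith
      push_cast
      linarith
  obtain ⟨j, hj⟩ := exists_nat_gt (κ₀ / δ)
  obtain ⟨κ, hκ, hκj, -⟩ := key j
  rw [div_lt_iff₀ hδ0] at hj
  linarith

/-- No positive solution exists: the lower bound coming from the spheres has exponent
`κ = (n-α)/2`, and the equation improves `κ` to `pκ - (α+τ)`. -/
theorem PositiveSolution.false (h : PositiveSolution n α r c θ f u)
    (hf3 : AssumptionF3 n α r f) : False := by
  obtain ⟨K, C, σ, τ, p, hK, hC, hσ, hp, hcase, hf⟩ := hf3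
  have hr := h.r_pos
  obtain ⟨z, ε, hz, hε, hε2, hball⟩ := hK.exists_ball h.n_pos
  obtain ⟨k₀, hk₀, hu₀⟩ := h.exists_rpow_le (R := 2 * r) (by linarith)
  set R := 4 * σ * r with hR
  have hσr : r < σ * r := by nlinarith
  have hR1 : 2 * r < R := by rw [hR]; linarith
  have hR2 : 2 * σ * r ≤ R := by rw [hR]; linarith
  set P : ℝ → Prop := fun κ => ∃ k : ℝ, 0 < k ∧ ∀ y, R ≤ ‖y‖ → k * ‖y‖ ^ (-κ) ≤ u y
  have hP₀ : P (((n : ℝ) - α) / 2) := ⟨k₀, hk₀, fun y hy => hu₀ y (hR1.trans_le hy)⟩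
  have hstep : ∀ κ, P κ → 0 < p * κ - (α + τ) ∧ P (p * κ - (α + τ)) := by
    rintro κ ⟨k, hk, hu⟩
    obtain ⟨k', hk', hint⟩ :=
      h.exists_le_setIntegral_ball hC hp hR1.le hR2 hz hε hε2 hball hf hk hu
    have hneg := h.exponent_neg (by linarith) hz hε2 hk' hint
    refine ⟨by linarith, k' * 4 ^ (α + τ - p * κ), by positivity, fun x hx => ?_⟩
    have hxr : r < ‖x‖ := by linarith
    have hx0 : 0 < ‖x‖ := hr.trans hxr
    have h1 := hint x hx (4 * ‖x‖) le_rfl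
    rw [Real.mul_rpow (by norm_num) hx0.le] at h1
    rw [neg_sub, mul_assoc, h.eq x hxr]
    refine h1.trans (h.setIntegral_le hxr (isOpen_exteriorDomain n r).measurableSet (fun y hy => ?_)
      subset_rfl)
    have := (norm_mem_of_mem_ball hz hε2 (by positivity) hy).1
    show r < ‖y‖
    linarith
  rcases hcase with ⟨hαn, hτ, hpn⟩ | ⟨hαn, hτ⟩
  · have hnα : 0 < (n : ℝ) - α := sub_pos.2 hαn
    rw [lt_div_iff₀ hnα] at hpn
    exact not_forall_iterate (by positivity) (by linarith) (by linarith) hP₀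
      fun κ _ => hstep κ
  · have := (hstep _ hP₀).1
    rw [hαn, sub_self, zero_div, mul_zero] at this
    linarith

end LowerBounds

end ExteriorLiouville

theorem theorem1p2 (n : ℕ) (hn : 2 ≤ n) (α : ℝ) (hα : 0 < α) (hα2 : α ≤ 2) (r : ℝ) (hr : 0 < r)
    -- the positive normalisation constant of the Green's function
    (c : ℝ) (hc : 0 < c)
    (f : EuclideanSpace ℝ (Fin n) → ℝ → ℝ)
    (hf : ∀ x ∈ ExteriorLiouville.exteriorDomain n r, ∀ s : ℝ, 0 ≤ s → 0 ≤ f x s)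
    (hsub : ExteriorLiouville.Subcritical n α r f)
    (hf1 : ExteriorLiouville.AssumptionF1 n r f)
    (hf2 : ExteriorLiouville.AssumptionF2 n α r f)
    (hf3 : ExteriorLiouville.AssumptionF3 n α r f)
    (u : EuclideanSpace ℝ (Fin n) → ℝ)
    (hu : ContinuousOn u (closure (ExteriorLiouville.exteriorDomain n r)))
    (hu0 : ∀ x ∈ closure (ExteriorLiouville.exteriorDomain n r), 0 ≤ u x)
    (hsol : ExteriorLiouville.SolvesIE n α r c f u) :
    ∀ x ∈ closure (ExteriorLiouville.exteriorDomain n r), u x = 0 := by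
  open ExteriorLiouville in
  by_contra! hne
  obtain ⟨x₀, hx₀, hux₀⟩ := hne
  have hn0 : 0 < n := by omega
  have hαn : α ≤ n := hα2.trans (by exact_mod_cast hn)
  rw [closure_exteriorDomain hr] at *
  have hcl : ∀ x : EuclideanSpace ℝ (Fin n), r < ‖x‖ → x ∈ closure (exteriorDomain n r) :=
    fun x hx => subset_closure hx
  -- on the sphere `|x| = r` the kernel, hence `u`, vanishes by definition
  have hx₀r : r < ‖x₀‖ := by
    by_contra hx
    refine hux₀ ?_
    have : ∀ y, green n α r c x₀ y = 0 := fun y => if_neg fun h => hx h.1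
    simp [(hsol x₀ (by rwa [closure_exteriorDomain hr])).2, this]
  have hscal : ∀ x, r < ‖x‖ → ∀ t, 1 < t → ∀ v, 0 < v →
      f x v < t ^ ((n : ℝ) + α) * f (t ^ 2 • x) (t ^ (α - n) * v) :=
    fun x hx t ht v hv => hsub.scaling hr hαn hx ht hv
  have hu0' : ∀ x, r < ‖x‖ → 0 ≤ u x := fun x hx => hu0 x hx.le
  have hint : ∀ x, r < ‖x‖ →
      IntegrableOn (fun y => green n α r c x y * f y (u y)) (exteriorDomain n r) :=
    fun x hx => (hsol x (hcl x hx)).1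
  have heq : ∀ x, r < ‖x‖ → u x = ∫ y in exteriorDomain n r, green n α r c x y * f y (u y) :=
    fun x hx => (hsol x (hcl x hx)).2
  have hpos : ∀ x, r < ‖x‖ → 0 < u x := fun x hx => by
    rw [heq x hx]
    exact pos_of_solvesIE hn0 hα hr hc hf (fun y hy v hv => pos_of_scaling hr hf hscal hy hv)
      (hu.mono fun y hy => (show r < ‖y‖ from hy).le) hu0' hx₀r
      ((hu0' x₀ hx₀r).lt_of_ne (Ne.symm hux₀)) hx (hint x hx)
  obtain ⟨θ, hθ, hlip⟩ := hf2
  have hsolution : PositiveSolution n α r c θ f u :=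
    { n_pos := hn0, α_pos := hα, α_le := hαn, r_pos := hr, c_pos := hc, θ_lt := hθ,
      nonneg := hf, scaling := hscal, mono := hf1,
      lip := hlip.exists_lipschitz_of_weight, cont := hu, pos := hpos, integrable := hint,
      eq := heq }
  exact hsolution.false hf3
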